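/- \textbf{Setting.} Let $\mathcal H$ be a separable complex Hilbert space, $\mathcal N$ a bounded self-adjoint operator on $\mathcal H$ with spectrum $\sigma(\mathcal N)\subset\mathbb R$ and spectral projections $\Pi(\cdot)$, and $\rho$ a density matrix on $\mathcal H$ (positive, trace class, $\operatorname{tr}\rho=1$). Let $\lambda_\rho$ be the spectral measure of $\mathcal N$ in the state $\rho$, i.e. $\operatorname{tr}(g(\mathcal N)\rho)=\int g\,d\lambda_\rho$ for bounded Borel functions $g$. Let $(\mathcal X,\Sigma_P,\mu)$ be a $\sigma$-finite measure space and $(\xi,\nu)\mapsto V_\xi(\nu)\in\mathbb C$ a measurable function on $\mathcal X\times\mathbb R$ such that each $V_\xi$ is bounded and $\int_{\mathcal X}|V_\xi(\nu)|^2\,d\mu(\xi)=1$ for all $\nu\in\mathbb R$. Put $V_\xi=V_\xi(\mathcal N)$ (Borel functional calculus), and, for $\underline\xi=(\xi_1,\xi_2,\dots)\in\Xi=\mathcal X^{\mathbb N}$, $V_k=V_{\xi_k}\cdots V_{\xi_1}$ and $\rho_k=V_k\rho V_k^*/\operatorname{tr}(V_k\rho V_k^*)$. Let $\mathbb P_\rho$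 be the probability measure on $\Xi$ (with the product $\sigma$-algebra) under which, for every $k$, $(\xi_1,\dots,\xi_k)$ has density $\operatorname{tr}(V_k\rho V_k^*)$ with respect to $\mu^{\otimes k}$. Let $f(\xi|\nu)=|V_\xi(\nu)|^2$, $d\mu_\nu=f(\cdot|\nu)\,d\mu$, $l(\nu|\xi)=\log f(\xi|\nu)\in[-\infty,\infty)$ and $l_k(\nu)=\frac1k\sum_{j=1}^k l(\nu|\xi_j)$. For $k\ge1$ let $\hat{\mathcal N}_k=\hat{\mathcal N}_k(\underline\xi)\in\sigma(\mathcal N)$ be any measurable choice of a maximizer of $l_k$ over $\sigma(\mathcal N)$ (maximum-likelihood estimator). For $\nu\in\sigma(\mathcal N)$ and a nonempty closed set $N\subset\sigma(\mathcal N)$ let $$S(\nu|N)=\min_{\nu'\in N}\int_{\mathcal X}\big(l(\nu|\xi)-l(\nu'|\xi)\big)\,d\mu_\nu(\xi)$$ be the relative entropy. \textbf{Assumption.} (0) $f(\cdot|\nu)\in L^1(\mathcal X,\mu)$ for $\nu\in\sigma(\mathcal N)$. (1) Identifiability: for $\nu\ne\nu'$ in $\sigma(\mathcal N)$, $f(\cdot|\nu)$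 and $f(\cdot|\nu')$ are different elements of $L^1(\mathcal X,\mu)$. (2) Continuity: for every $\xi\in\mathcal X$, $\nu\mapsto f(\xi|\nu)$ is continuous on $\sigma(\mathcal N)$. (3) Dominance: $\sup_{\nu'\in\sigma(\mathcal N)}|l(\nu'|\cdot)|\in L^1(\mathcal X,\mu_\nu)$ for every $\nu\in\sigma(\mathcal N)$ (with $|-\infty|=\infty$). \textbf{Theorem.} Under this assumption the measure $\mathbb P_\rho$ exists, and there is a random variable $\hat{\mathcal N}_\infty$ on $\Xi$ such that $\hat{\mathcal N}_k\to\hat{\mathcal N}_\infty$ $\mathbb P_\rho$-almost surely and, for every Borel set $N\subset\mathbb R$, $$\mathbb P_\rho\big(\hat{\mathcal N}_\infty\in N\big)=\operatorname{tr}(\Pi(N)\rho).$$ Furthermore, if $N=\overline O$ is the closure of a nonempty relatively open subset $O$ of $\sigma(\mathcal N)$ and $N\subset\operatorname{supp}\lambda_\rho$, then, $\mathbb P_\rho$-almost surely, $\operatorname{tr}(\Pi(N)\rho_k)>0$ for all $k$ and $$-\lim_{k\to\infty}\frac1k\log\operatorname{tr}(\Pi(N)\rho_k)=S(\hat{\mathcal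 N}_\infty|N).$$ -/

import Mathlib

open MeasureTheory Filter Topology
open scoped ENNReal NNReal InnerProductSpace

namespace NonDemolition

variable {H : Type*} [NormedAddCommGroup H] [InnerProductSpace ℂ H] [CompleteSpace H]

/-- `f ↦ ⟨x, f(N) x⟩` on continuous functions on the spectrum. -/
noncomputable def spectralFunctional (N : H →L[ℂ] H) (hN : IsSelfAdjoint N) (x : H) :
    CompactlySupportedContinuousMap (spectrum ℝ N) ℝ →ₚ[ℝ] ℝ :=
  PositiveLinearMap.mk₀
    { toFun := fun f => (⟪x, cfcHom hN f.toContinuousMap x⟫_ℂ).re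
      map_add' := fun f g => by
        have : (f + g).toContinuousMap = f.toContinuousMap + g.toContinuousMap := rfl
        simp [this]
      map_smul' := fun c f => by
        have : (c • f).toContinuousMap = c • f.toContinuousMap := rfl
        simp [this] }
    (fun f hf => by
      have h : 0 ≤ cfcHom hN f.toContinuousMap := (cfcHom_nonneg_iff hN).2 (fun t => hf t)
      have h2 := (ContinuousLinearMap.nonneg_iff_isPositive _).1 h
      exact h2.re_inner_nonneg_right x)

/-- The spectral measure `μ_x` of the self-adjoint operator `N` at the vector `x`, carried by the
spectrum of `N`: the Riesz measure with `∫ f dμ_x = ⟨x, f(N) x⟩` for continuous `f`. -/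
noncomputable def vectorSpectralMeasure (N : H →L[ℂ] H) (hN : IsSelfAdjoint N) (x : H) :
    Measure ℝ :=
  (RealRMK.rieszMeasure (spectralFunctional N hN x)).map Subtype.val

theorem compactSpace_spectrum (N : H →L[ℂ] H) : CompactSpace (spectrum ℝ N) :=
  isCompact_iff_compactSpace.1 (spectrum.isCompact N)

instance isFiniteMeasure_vectorSpectralMeasure (N : H →L[ℂ] H) (hN : IsSelfAdjoint N) (x : H) :
    IsFiniteMeasure (vectorSpectralMeasure N hN x) := by
  have := compactSpace_spectrum N
  unfold vectorSpectralMeasure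
  have : IsFiniteMeasure (RealRMK.rieszMeasure (spectralFunctional N hN x)) :=
    ⟨isCompact_univ.measure_lt_top⟩
  infer_instance

theorem integral_vectorSpectralMeasure (N : H →L[ℂ] H) (hN : IsSelfAdjoint N) (x : H)
    (f : C(ℝ, ℝ)) :
    ∫ t, f t ∂(vectorSpectralMeasure N hN x) =
      (⟪x, cfcHom hN (f.restrict (spectrum ℝ N)) x⟫_ℂ).re := by
  have := compactSpace_spectrum N
  unfold vectorSpectralMeasure
  rw [integral_map (by fun_prop) (by fun_prop)]
  exact RealRMK.integral_rieszMeasure (spectralFunctional N hN x)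
    (CompactlySupportedContinuousMap.continuousMapEquiv (f.restrict (spectrum ℝ N)))

theorem measureReal_vectorSpectralMeasure_univ (N : H →L[ℂ] H) (hN : IsSelfAdjoint N) (x : H) :
    (vectorSpectralMeasure N hN x).real Set.univ = ‖x‖ ^ 2 := by
  have h := integral_vectorSpectralMeasure N hN x 1
  have h1 : (1 : C(ℝ, ℝ)).restrict (spectrum ℝ N) = 1 := rfl
  rw [h1, map_one] at h
  simpa [inner_self_eq_norm_sq_to_K, ← Complex.ofReal_pow] using h

theorem integrable_vectorSpectralMeasure (N : H →L[ℂ] H) (hN : IsSelfAdjoint N) (x : H)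
    {g : ℝ → ℂ} (hg : Measurable g) {C : ℝ} (hC : ∀ t, ‖g t‖ ≤ C) :
    Integrable g (vectorSpectralMeasure N hN x) :=
  Integrable.of_bound hg.aestronglyMeasurable C (Eventually.of_forall hC)

/-- A real linear relation between the quadratic forms `x ↦ ⟨x, T x⟩` that holds for all bounded
operators `T` passes to the spectral measures. -/
theorem sum_integral_eq_zero (N : H →L[ℂ] H) (hN : IsSelfAdjoint N) {g : ℝ → ℂ}
    (hg : Measurable g) {C : ℝ} (hC : ∀ t, ‖g t‖ ≤ C) {n : ℕ} (c : Fin n → ℝ) (u : Fin n → H)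
    (h : ∀ T : H →L[ℂ] H, ∑ i, (c i : ℂ) * ⟪u i, T (u i)⟫_ℂ = 0) :
    ∑ i, (c i : ℂ) * ∫ t, g t ∂(vectorSpectralMeasure N hN (u i)) = 0 := by
  have key : ∑ i, (c i).toNNReal • vectorSpectralMeasure N hN (u i) =
      ∑ i, (-c i).toNNReal • vectorSpectralMeasure N hN (u i) := by
    apply ext_of_forall_integral_eq_of_IsFiniteMeasure
    intro f
    have hf : ∀ i, Integrable f (vectorSpectralMeasure N hN (u i)) := fun i => f.integrable _
    rw [integral_finsetSum_measure (fun i _ => (hf i).smul_measure_nnreal),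
      integral_finsetSum_measure (fun i _ => (hf i).smul_measure_nnreal), ← sub_eq_zero,
      ← Finset.sum_sub_distrib]
    have h0 := congrArg Complex.re (h (cfcHom hN (f.toContinuousMap.restrict (spectrum ℝ N))))
    simp only [Complex.re_sum, Complex.re_ofReal_mul, Complex.zero_re] at h0
    rw [← h0]
    refine Finset.sum_congr rfl fun i _ => ?_
    have h1 := integral_vectorSpectralMeasure N hN (u i) f.toContinuousMap
    have h2 : ((c i).toNNReal : ℝ) - ((-c i).toNNReal : ℝ) = c i := by
      simp only [Real.coe_toNNReal', max_zero_sub_max_neg_zero_eq_self]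
    rw [integral_smul_nnreal_measure, integral_smul_nnreal_measure, NNReal.smul_def,
      NNReal.smul_def, ← sub_smul, h2, smul_eq_mul, ← h1]
    rfl
  have h2 := congrArg (fun m => ∫ t, g t ∂m) key
  have hi : ∀ i, Integrable g (vectorSpectralMeasure N hN (u i)) :=
    fun i => integrable_vectorSpectralMeasure N hN _ hg hC
  rw [integral_finsetSum_measure (fun i _ => (hi i).smul_measure_nnreal),
      integral_finsetSum_measure (fun i _ => (hi i).smul_measure_nnreal), ← sub_eq_zero,
      ← Finset.sum_sub_distrib] at h2
  rw [← h2]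
  refine Finset.sum_congr rfl fun i _ => ?_
  have h2 : ((c i).toNNReal : ℝ) - ((-c i).toNNReal : ℝ) = c i := by
    simp only [Real.coe_toNNReal', max_zero_sub_max_neg_zero_eq_self]
  rw [integral_smul_nnreal_measure, integral_smul_nnreal_measure, NNReal.smul_def,
    NNReal.smul_def, ← sub_smul, h2, Complex.real_smul]

/-- The bounded quadratic form `x ↦ ∫ g dμ_x` comes from a bounded operator. -/
theorem exists_borelCalculus (N : H →L[ℂ] H) (hN : IsSelfAdjoint N) {g : ℝ → ℂ}
    (hg : Measurable g) {C : ℝ} (hC : ∀ t, ‖g t‖ ≤ C) :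
    ∃ A : H →L[ℂ] H, ∀ x, ⟪x, A x⟫_ℂ = ∫ t, g t ∂(vectorSpectralMeasure N hN x) := by
  set Q : H → ℂ := fun x => ∫ t, g t ∂(vectorSpectralMeasure N hN x) with hQ
  have key : ∀ {n : ℕ} (c : Fin n → ℝ) (u : Fin n → H)
      (_ : ∀ T : H →L[ℂ] H, ∑ i, (c i : ℂ) * ⟪u i, T (u i)⟫_ℂ = 0),
      ∑ i, (c i : ℂ) * Q (u i) = 0 := fun c u h => sum_integral_eq_zero N hN hg hC c u h
  have hQb : ∀ x, ‖Q x‖ ≤ C * ‖x‖ ^ 2 := fun x => by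
    have := norm_integral_le_of_norm_le_const (μ := vectorSpectralMeasure N hN x)
      (Eventually.of_forall hC)
    rwa [measureReal_vectorSpectralMeasure_univ] at this
  have hC0 : 0 ≤ C := (norm_nonneg _).trans (hC 0)
  set D : H → H → ℂ := fun x y => Q (x + y) - Q (x - y) with hD
  have hDl : ∀ x x' y, D (x + x') y = D x y + D x' y := fun x x' y => by
    have := key ![1, -1, -1, 1, -1, 1] ![x + x' + y, x + x' - y, x + y, x - y, x' + y, x' - y]
      (fun T => by
        simp [Fin.sum_univ_succ, inner_add_left, inner_add_right, inner_sub_left, inner_sub_right]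
        ring)
    simp [Fin.sum_univ_succ] at this
    simp only [hD]
    linear_combination this
  have hDr : ∀ x y y', D x (y + y') = D x y + D x y' := fun x y y' => by
    have := key ![1, -1, -1, 1, -1, 1] ![x + (y + y'), x - (y + y'), x + y, x - y, x + y', x - y']
      (fun T => by
        simp [Fin.sum_univ_succ, inner_add_left, inner_add_right, inner_sub_left, inner_sub_right]
        ring)
    simp [Fin.sum_univ_succ] at this
    simp only [hD]
    linear_combination this
  have hDsr : ∀ (a b : ℝ) x y, D x ((a + b * Complex.I : ℂ) • y) =
      a * D x y + b * D x (Complex.I • y) := fun a b x y => by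
    have := key ![1, -1, -a, a, -b, b] ![x + (a + b * Complex.I : ℂ) • y,
        x - (a + b * Complex.I : ℂ) • y, x + y, x - y, x + Complex.I • y, x - Complex.I • y]
      (fun T => by
        simp [Fin.sum_univ_succ, inner_add_left, inner_add_right, inner_sub_left, inner_sub_right,
          inner_smul_left, inner_smul_right]
        ring)
    simp [Fin.sum_univ_succ] at this
    simp only [hD]
    linear_combination this
  have hDsl : ∀ (a b : ℝ) x y, D ((a + b * Complex.I : ℂ) • x) y =
      a * D x y - b * D x (Complex.I • y) := fun a b x y => by
    have := key ![1, -1, -a, a, b, -b] ![(a + b * Complex.I : ℂ) • x + y,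
        (a + b * Complex.I : ℂ) • x - y, x + y, x - y, x + Complex.I • y, x - Complex.I • y]
      (fun T => by
        simp [Fin.sum_univ_succ, inner_add_left, inner_add_right, inner_sub_left, inner_sub_right,
          inner_smul_left, inner_smul_right]
        ring)
    simp [Fin.sum_univ_succ] at this
    simp only [hD]
    linear_combination this
  have hDn : ∀ x y, D x (-y) = - D x y := fun x y => by
    simp only [hD, sub_neg_eq_add, ← sub_eq_add_neg]; ring
  set B : H → H → ℂ := fun x y => (D x y - Complex.I * D x (Complex.I • y)) / 4 with hB
  have hBsr : ∀ (c : ℂ) x y, B x (c • y) = c * B x y := fun c x y => by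
    have h1 := hDsr c.re c.im x y
    have h2 := hDsr c.re c.im x (Complex.I • y)
    rw [Complex.re_add_im] at h1 h2
    rw [smul_comm c, smul_smul Complex.I Complex.I, Complex.I_mul_I, neg_one_smul, hDn] at h2
    simp only [hB]
    rw [h1, h2]
    linear_combination (c.im * D x (Complex.I • y) / 4) * Complex.I_sq +
      ((D x y - Complex.I * D x (Complex.I • y)) / 4) * Complex.re_add_im c
  have hBsl : ∀ (c : ℂ) x y, B (c • x) y = (starRingEnd ℂ) c * B x y := fun c x y => by
    have h1 := hDsl c.re c.im x y
    have h2 := hDsl c.re c.im x (Complex.I • y)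
    rw [Complex.re_add_im] at h1 h2
    rw [smul_smul, Complex.I_mul_I, neg_one_smul, hDn] at h2
    have h3 : (starRingEnd ℂ) c = c.re - c.im * Complex.I := by
      apply Complex.ext <;> simp
    simp only [hB]
    rw [h1, h2, h3]
    linear_combination (-c.im * D x (Complex.I • y) / 4) * Complex.I_sq
  have hBd : ∀ x, B x x = Q x := fun x => by
    have h1 := key ![1, -1, -4] ![x + x, x - x, x] (fun T => by
        simp [Fin.sum_univ_succ, inner_add_left, inner_add_right]
        ring)
    have h2 := key ![1, -1] ![x + Complex.I • x, x - Complex.I • x] (fun T => by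
        simp [Fin.sum_univ_succ, inner_add_left, inner_add_right, inner_sub_left, inner_sub_right,
          inner_smul_left, inner_smul_right]
        ring)
    simp [Fin.sum_univ_succ] at h1 h2
    simp only [hB, hD, sub_self]
    linear_combination h1 / 4 - Complex.I / 4 * h2
  have hDb : ∀ x y, ‖D x y‖ ≤ 2 * C * (‖x‖ ^ 2 + ‖y‖ ^ 2) := fun x y => by
    have h1 := parallelogram_law_with_norm ℂ x y
    have h2 := norm_sub_le (Q (x + y)) (Q (x - y))
    have h3 := hQb (x + y)
    have h4 := hQb (x - y)
    simp only [hD]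
    nlinarith
  have hBb1 : ∀ x y, ‖B x y‖ ≤ C * (‖x‖ ^ 2 + ‖y‖ ^ 2) := fun x y => by
    have h1 := hDb x y
    have h2 := hDb x (Complex.I • y)
    have h3 := norm_sub_le (D x y) (Complex.I * D x (Complex.I • y))
    rw [norm_smul, Complex.norm_I, one_mul] at h2
    rw [norm_mul, Complex.norm_I, one_mul] at h3
    simp only [hB, norm_div, Complex.norm_ofNat]
    linarith
  have hBb : ∀ x y, ‖B x y‖ ≤ 2 * C * ‖x‖ * ‖y‖ := fun x y => by
    rcases eq_or_ne x 0 with rfl | hx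
    · have := hBsl 0 0 y
      simp at this
      simp [this]
    rcases eq_or_ne y 0 with rfl | hy
    · have := hBsr 0 x 0
      simp at this
      simp [this]
    have hx' : 0 < ‖x‖ := norm_pos_iff.2 hx
    have hy' : 0 < ‖y‖ := norm_pos_iff.2 hy
    have h1 := hBb1 (((‖x‖⁻¹ : ℝ) : ℂ) • x) (((‖y‖⁻¹ : ℝ) : ℂ) • y)
    rw [hBsl, hBsr, norm_smul, norm_smul, norm_mul, norm_mul, RCLike.norm_conj, Complex.norm_real,
      Complex.norm_real, norm_inv, norm_inv, norm_norm, norm_norm, inv_mul_cancel₀ hx'.ne',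
      inv_mul_cancel₀ hy'.ne'] at h1
    rw [← mul_assoc, ← mul_inv, inv_mul_le_iff₀ (by positivity)] at h1
    linarith
  let L : H →ₗ⋆[ℂ] H →ₗ[ℂ] ℂ := LinearMap.mk₂'ₛₗ (starRingEnd ℂ) (RingHom.id ℂ) B
    (fun x x' y => by simp only [hB, hDl]; ring)
    (fun c x y => hBsl c x y)
    (fun x y y' => by simp only [hB, hDr, smul_add]; ring)
    (fun c x y => hBsr c x y)
  let L' : H →L⋆[ℂ] H →L[ℂ] ℂ := L.mkContinuous₂ (2 * C) hBb
  refine ⟨ContinuousLinearMap.adjoint (InnerProductSpace.continuousLinearMapOfBilin L'), fun x => ?_⟩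
  rw [ContinuousLinearMap.adjoint_inner_right,
    InnerProductSpace.continuousLinearMapOfBilin_apply]
  exact hBd x

open Classical in
/-- Bounded Borel functional calculus: `g(N)` is the bounded operator with
`⟨x, g(N) x⟩ = ∫ g dμ_x` for all vectors `x`; for bounded Borel functions `g` it exists by
`inner_borelCalculus`. -/
noncomputable def borelCalculus (N : H →L[ℂ] H) (hN : IsSelfAdjoint N) (g : ℝ → ℂ) : H →L[ℂ] H :=
  if h : ∃ A : H →L[ℂ] H, ∀ x, ⟪x, A x⟫_ℂ = ∫ t, g t ∂(vectorSpectralMeasure N hN x)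
  then h.choose else 0

theorem inner_borelCalculus (N : H →L[ℂ] H) (hN : IsSelfAdjoint N) {g : ℝ → ℂ}
    (hg : Measurable g) {C : ℝ} (hC : ∀ t, ‖g t‖ ≤ C) (x : H) :
    ⟪x, borelCalculus N hN g x⟫_ℂ = ∫ t, g t ∂(vectorSpectralMeasure N hN x) := by
  have h := exists_borelCalculus N hN hg hC
  rw [borelCalculus, dif_pos h]
  exact h.choose_spec x

/-- The spectral projection `Π(B)` of `N` associated with a Borel set `B`. -/
noncomputable def spectralProjection (N : H →L[ℂ] H) (hN : IsSelfAdjoint N) (B : Set ℝ) :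
    H →L[ℂ] H :=
  borelCalculus N hN (B.indicator fun _ => 1)

variable (H) in
/-- The index set of the orthonormal basis used to compute traces. -/
def basisIndex : Set H := (exists_hilbertBasis ℂ H).choose

variable (H) in
/-- A fixed orthonormal (Hilbert) basis of `H`. -/
noncomputable def onBasis : HilbertBasis (basisIndex H) ℂ H :=
  (exists_hilbertBasis ℂ H).choose_spec.choose

/-- The trace `∑ᵢ ⟨eᵢ, A eᵢ⟩`; it is only applied to trace class operators (products of a density
matrix with bounded operators), for which it does not depend on the orthonormal basis. -/
noncomputable def trace (A : H →L[ℂ] H) : ℂ :=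
  ∑' i, ⟪onBasis H i, A (onBasis H i)⟫_ℂ

/-- Density matrices: positive trace class operators of trace one. -/
structure IsDensityMatrix (ρ : H →L[ℂ] H) : Prop where
  isPositive : ρ.IsPositive
  hasSum_one : HasSum (fun i => ⟪onBasis H i, ρ (onBasis H i)⟫_ℂ) 1

/-- If `∑ⱼ ‖T eⱼ‖²` is finite for a symmetric `T`, then `∑ᵢ ⟨eᵢ, A T² eᵢ⟩ = ∑ⱼ ⟨T eⱼ, A T eⱼ⟩`. -/
theorem hasSum_inner_mul_sq {ι : Type*} (b : HilbertBasis ι ℂ H) (T A : H →L[ℂ] H)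
    (hTs : ∀ x y, ⟪T x, y⟫_ℂ = ⟪x, T y⟫_ℂ) (hn : Summable fun j => ‖T (b j)‖ ^ 2) :
    HasSum (fun j => ⟪T (b j), A (T (b j))⟫_ℂ) (∑' i, ⟪b i, A (T (T (b i)))⟫_ℂ) := by
  have hsq : ∀ v : H, HasSum (fun i => ‖⟪b i, v⟫_ℂ‖ ^ 2) (‖v‖ ^ 2) := fun v => by
    have h1 := Complex.hasSum_re (b.hasSum_inner_mul_inner v v)
    rw [inner_self_eq_norm_sq_to_K] at h1
    convert h1 using 2 with i
    · rw [← inner_conj_symm v (b i), ← Complex.normSq_eq_conj_mul_self, Complex.ofReal_re,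
        Complex.normSq_eq_norm_sq]
    · norm_cast
  have hdom : ∀ S : H →L[ℂ] H, Summable
      (fun p : ι × ι => ‖⟪b p.2, S (T (b p.1))⟫_ℂ‖ ^ 2) := fun S => by
    refine (summable_prod_of_nonneg (fun p => sq_nonneg _)).2 ⟨fun j => (hsq (S (T (b j)))).summable, ?_⟩
    have h0 : ∀ j, ∑' i, ‖⟪b i, S (T (b j))⟫_ℂ‖ ^ 2 = ‖S (T (b j))‖ ^ 2 :=
      fun j => (hsq (S (T (b j)))).tsum_eq
    simp only [h0]
    refine Summable.of_nonneg_of_le (fun j => sq_nonneg _) (fun j => ?_)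
      (hn.mul_left (‖S‖ ^ 2))
    rw [← mul_pow]
    gcongr
    exact S.le_opNorm _
  have hFs : Summable
      (fun p : ι × ι => ⟪T (b p.1), b p.2⟫_ℂ * ⟪b p.2, A (T (b p.1))⟫_ℂ) := by
    refine Summable.of_norm_bounded (((hdom 1).add (hdom A)).mul_left (1 / 2)) fun p => ?_
    rw [norm_mul, norm_inner_symm (T (b p.1)) (b p.2)]
    have h1 : (1 : H →L[ℂ] H) (T (b p.1)) = T (b p.1) := rfl
    rw [h1]
    nlinarith [sq_nonneg (‖⟪b p.2, T (b p.1)⟫_ℂ‖ - ‖⟪b p.2, A (T (b p.1))⟫_ℂ‖)]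
  have h1 : ∀ j, HasSum (fun i => ⟪T (b j), b i⟫_ℂ * ⟪b i, A (T (b j))⟫_ℂ)
      ⟪T (b j), A (T (b j))⟫_ℂ := fun j => b.hasSum_inner_mul_inner _ _
  have h2 : ∀ i, HasSum (fun j => ⟪T (b j), b i⟫_ℂ * ⟪b i, A (T (b j))⟫_ℂ)
      ⟪b i, A (T (T (b i)))⟫_ℂ := fun i => by
    have h3 := b.hasSum_inner_mul_inner (T (ContinuousLinearMap.adjoint A (b i))) (T (b i))
    rw [hTs, ContinuousLinearMap.adjoint_inner_left] at h3
    have h4 : (fun j => ⟪T (b j), b i⟫_ℂ * ⟪b i, A (T (b j))⟫_ℂ) = fun j =>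
        ⟪T (ContinuousLinearMap.adjoint A (b i)), b j⟫_ℂ * ⟪b j, T (b i)⟫_ℂ := by
      funext j
      rw [hTs (ContinuousLinearMap.adjoint A (b i)), ContinuousLinearMap.adjoint_inner_left,
        hTs (b j), mul_comm]
    rw [h4]
    exact h3
  have h5 := hFs.hasSum.prod_fiberwise h1
  have h6 := ((Equiv.prodComm ι ι).hasSum_iff.2 hFs.hasSum).prod_fiberwise h2
  rwa [h6.tsum_eq]

/-- For a density matrix `ρ` and a bounded operator `A`, `tr(A ρ) = ∑ⱼ ⟨√ρ eⱼ, A √ρ eⱼ⟩`. -/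
theorem hasSum_trace_mul {ρ : H →L[ℂ] H} (hρ : IsDensityMatrix ρ) :
    (HasSum (fun j => ‖CFC.sqrt ρ (onBasis H j)‖ ^ 2) 1) ∧ ∀ A : H →L[ℂ] H,
    HasSum (fun j => ⟪CFC.sqrt ρ (onBasis H j), A (CFC.sqrt ρ (onBasis H j))⟫_ℂ)
      (trace (A * ρ)) := by
  have hρ0 : 0 ≤ ρ := (ContinuousLinearMap.nonneg_iff_isPositive _).2 hρ.isPositive
  have hTT : ∀ x, ρ x = CFC.sqrt ρ (CFC.sqrt ρ x) := fun x => by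
    conv_lhs => rw [← CFC.sqrt_mul_sqrt_self ρ hρ0]
    rfl
  have hTs : ∀ x y, ⟪CFC.sqrt ρ x, y⟫_ℂ = ⟪x, CFC.sqrt ρ y⟫_ℂ :=
    ((ContinuousLinearMap.nonneg_iff_isPositive _).1 (CFC.sqrt_nonneg ρ)).isSymmetric
  have hn : HasSum (fun j => ‖CFC.sqrt ρ (onBasis H j)‖ ^ 2) 1 := by
    have h1 := Complex.hasSum_re hρ.hasSum_one
    simp only [Complex.one_re] at h1
    convert h1 using 2 with j
    rw [hTT, ← hTs, inner_self_eq_norm_sq_to_K]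
    norm_cast
  refine ⟨hn, fun A => ?_⟩
  have h := hasSum_inner_mul_sq (onBasis H) (CFC.sqrt ρ) A hTs hn.summable
  simp only [← hTT] at h
  exact h

/-- `m` is the spectral measure of `N` with respect to the state `ρ`:
`tr(g(N) ρ) = ∫ g dm` for all bounded Borel functions `g`. -/
def IsSpectralMeasure (N : H →L[ℂ] H) (hN : IsSelfAdjoint N) (ρ : H →L[ℂ] H) (m : Measure ℝ) :
    Prop :=
  IsFiniteMeasure m ∧ ∀ g : ℝ → ℂ, Measurable g → (∃ C : ℝ, ∀ t, ‖g t‖ ≤ C) →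
    trace (borelCalculus N hN g * ρ) = ∫ t, g t ∂m

theorem exists_isSpectralMeasure (N : H →L[ℂ] H) (hN : IsSelfAdjoint N) {ρ : H →L[ℂ] H}
    (hρ : IsDensityMatrix ρ) : ∃ m, IsSpectralMeasure N hN ρ m := by
  obtain ⟨hn, htr⟩ := hasSum_trace_mul hρ
  set m := Measure.sum fun j => vectorSpectralMeasure N hN (CFC.sqrt ρ (onBasis H j)) with hm
  have hfin : IsFiniteMeasure m := by
    refine ⟨?_⟩
    rw [hm, Measure.sum_apply _ MeasurableSet.univ]
    have h1 : ∀ j, vectorSpectralMeasure N hN (CFC.sqrt ρ (onBasis H j)) Set.univ =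
        ENNReal.ofReal (‖CFC.sqrt ρ (onBasis H j)‖ ^ 2) := fun j => by
      rw [← measureReal_vectorSpectralMeasure_univ N hN, ofReal_measureReal]
    simp only [h1]
    rw [← ENNReal.ofReal_tsum_of_nonneg (fun j => by positivity) hn.summable]
    exact ENNReal.ofReal_lt_top
  refine ⟨m, hfin, fun g hg ⟨C, hC⟩ => ?_⟩
  have hi : Integrable g m := Integrable.of_bound hg.aestronglyMeasurable C (Eventually.of_forall hC)
  have h1 := hasSum_integral_measure hi
  have h2 := htr (borelCalculus N hN g)
  simp only [inner_borelCalculus N hN hg hC] at h2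
  exact h2.unique h1

open Classical in
/-- The spectral measure `λ_ρ` of `N` with respect to the state `ρ`; for density matrices it exists
by `exists_isSpectralMeasure`. -/
noncomputable def stateSpectralMeasure (N : H →L[ℂ] H) (hN : IsSelfAdjoint N) (ρ : H →L[ℂ] H) :
    Measure ℝ :=
  if h : ∃ m, IsSpectralMeasure N hN ρ m then h.choose else 0

variable {X : Type*} [MeasurableSpace X]

/-- A measurable family `V_ξ` of bounded complex functions on `ℝ` with `∫ |V_ξ(ν)|² dμ(ξ) = 1` for
all `ν`. -/
structure IsJumpFamily (μ : Measure X) (V : X → ℝ → ℂ) : Prop where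
  measurable : Measurable (Function.uncurry V)
  bounded : ∀ ξ, ∃ C : ℝ, ∀ ν, ‖V ξ ν‖ ≤ C
  normalized : ∀ ν, ∫⁻ ξ, ENNReal.ofReal (‖V ξ ν‖ ^ 2) ∂μ = 1

/-- `V_k(ξ₁, …, ξ_k) = V_{ξ_k}(N) ⋯ V_{ξ_1}(N)`. -/
noncomputable def jumpProduct (N : H →L[ℂ] H) (hN : IsSelfAdjoint N) (V : X → ℝ → ℂ) {k : ℕ}
    (ξ : Fin k → X) : H →L[ℂ] H :=
  (List.ofFn fun i => borelCalculus N hN (V (ξ i))).reverse.prod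

/-- The unnormalized posterior state `V_k ρ V_k*`. -/
noncomputable def unnormalizedPosterior (N : H →L[ℂ] H) (hN : IsSelfAdjoint N) (V : X → ℝ → ℂ)
    (ρ : H →L[ℂ] H) {k : ℕ} (ξ : Fin k → X) : H →L[ℂ] H :=
  jumpProduct N hN V ξ * ρ * ContinuousLinearMap.adjoint (jumpProduct N hN V ξ)

/-- `P` is a law of the infinite sequence of outcomes: for every `k`, the law of the first `k`
outcomes is `tr(V_k ρ V_k*) dμ(ξ₁) ⋯ dμ(ξ_k)`. -/
def IsOutcomeLaw (N : H →L[ℂ] H) (hN : IsSelfAdjoint N) (μ : Measure X) [SigmaFinite μ]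
    (V : X → ℝ → ℂ) (ρ : H →L[ℂ] H) (P : Measure (ℕ → X)) : Prop :=
  ∀ (k : ℕ) (E : Set (Fin k → X)), MeasurableSet E →
    P {ξ | (fun i : Fin k => ξ i) ∈ E} =
      ∫⁻ ξ in E, ENNReal.ofReal (trace (unnormalizedPosterior N hN V ρ ξ)).re
        ∂(Measure.pi fun _ : Fin k => μ)

open Classical in
/-- The probability measure `ℙ_ρ` on the space of sequences of outcomes, determined by its
finite-dimensional distributions. -/
noncomputable def outcomeLaw (N : H →L[ℂ] H) (hN : IsSelfAdjoint N) (μ : Measure X) [SigmaFinite μ]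
    (V : X → ℝ → ℂ) (ρ : H →L[ℂ] H) : Measure (ℕ → X) :=
  if h : ∃ P, IsOutcomeLaw N hN μ V ρ P then h.choose else 0

/-- The posterior state `ρ_k = V_k ρ V_k* / tr(V_k ρ V_k*)` after the first `k` outcomes. -/
noncomputable def posterior (N : H →L[ℂ] H) (hN : IsSelfAdjoint N) (V : X → ℝ → ℂ)
    (ρ : H →L[ℂ] H) (k : ℕ) (ξ : ℕ → X) : H →L[ℂ] H :=
  (trace (unnormalizedPosterior N hN V ρ fun i : Fin k => ξ i))⁻¹ •
    unnormalizedPosterior N hN V ρ fun i : Fin k => ξ i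

/-- `f(ξ|ν) = |V_ξ(ν)|²`. -/
noncomputable def likelihood (V : X → ℝ → ℂ) (ξ : X) (ν : ℝ) : ℝ := ‖V ξ ν‖ ^ 2

/-- `l(ν|ξ) = log f(ξ|ν)`, with value `-∞` where `f(ξ|ν) = 0`. -/
noncomputable def logLikelihood (V : X → ℝ → ℂ) (ν : ℝ) (ξ : X) : EReal :=
  ENNReal.log (ENNReal.ofReal (likelihood V ξ ν))

/-- `l_k(ν|ξ) = (1/k) ∑_{j ≤ k} l(ν|ξ_j)`. -/
noncomputable def avgLogLikelihood (V : X → ℝ → ℂ) (k : ℕ) (ξ : ℕ → X) (ν : ℝ) : EReal :=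
  ((1 / k : ℝ) : EReal) * ∑ j ∈ Finset.range k, logLikelihood V ν (ξ j)

/-- `dμ_ν(ξ) = f(ξ|ν) dμ(ξ)`. -/
noncomputable def outcomeMeasure (μ : Measure X) (V : X → ℝ → ℂ) (ν : ℝ) : Measure X :=
  μ.withDensity fun ξ => ENNReal.ofReal (likelihood V ξ ν)

/-- Identifiability, continuity and dominance of the likelihood on the spectrum `σ`. -/
structure LikelihoodAssumption (μ : Measure X) (V : X → ℝ → ℂ) (σ : Set ℝ) : Prop where
  integrable : ∀ ν ∈ σ, Integrable (fun ξ => likelihood V ξ ν) μ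
  identifiable : ∀ ν ∈ σ, ∀ ν' ∈ σ, ν ≠ ν' →
    ¬ (fun ξ => likelihood V ξ ν) =ᵐ[μ] fun ξ => likelihood V ξ ν'
  continuousOn : ∀ ξ, ContinuousOn (fun ν => likelihood V ξ ν) σ
  dominated : ∀ ν ∈ σ, ∫⁻ ξ, ⨆ ν' ∈ σ, (logLikelihood V ν' ξ).abs ∂(outcomeMeasure μ V ν) < ∞

/-- `N̂_k`, `k ≥ 1`, is a measurable choice of a maximizer of `l_k` over the spectrum `σ`. -/
def IsMaximumLikelihoodEstimator (V : X → ℝ → ℂ) (σ : Set ℝ) (Nhat : ℕ → (ℕ → X) → ℝ) : Prop :=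
  ∀ k, 1 ≤ k → Measurable (Nhat k) ∧
    ∀ ξ, Nhat k ξ ∈ σ ∧ IsMaxOn (avgLogLikelihood V k ξ) σ (Nhat k ξ)

/-- The relative entropy `S(ν|C) = min_{ν' ∈ C} 𝔼_ν[l(ν|ξ) - l(ν'|ξ)]`. Under the likelihood
assumption, `l` is `μ_ν`-almost surely finite on the spectrum and the infimum over a nonempty
closed subset of the spectrum is a minimum. -/
noncomputable def relativeEntropy (μ : Measure X) (V : X → ℝ → ℂ) (ν : ℝ) (C : Set ℝ) : ℝ :=
  sInf ((fun ν' => ∫ ξ, ((logLikelihood V ν ξ).toReal - (logLikelihood V ν' ξ).toReal)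
    ∂(outcomeMeasure μ V ν)) '' C)

end NonDemolition

/-!
Diagonalising `N` turns the model into a Bayesian one. Under the trace, every `V_ξ(N)` acts as
multiplication by `V_ξ(ν)`, so the law of the outcomes is the mixture over `λ_ρ(dν)` of the laws
`μ_ν^{⊗ℕ}`, and `tr(Π(B) ρ_k)` is the posterior probability of `B` for the prior `λ_ρ`.

Under `μ_ν^{⊗ℕ}`, dominance gives a uniform law of large numbers over the compact spectrum:
`l_k` converges uniformly to `ν' ↦ 𝔼_ν[l(ν')]`. By Gibbs' inequality and identifiability `ν` is the
unique maximizer of the limit, so the estimator converges to `ν`; mixing over `ν`, its limit has law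
`λ_ρ`. The posterior probability of a set `C` is `∫_C exp(k l_k) dλ_ρ / ∫ exp(k l_k) dλ_ρ`, and the
Laplace principle gives the exponential rate `max_C 𝔼_ν[l] - 𝔼_ν[l(ν)] = -S(ν|C)`. It only uses that
`λ_ρ` charges every neighbourhood in `C` of a maximizer.
-/

namespace NonDemolition

section BoundedMeasurable

variable {α : Type*} [MeasurableSpace α] {g h : α → ℂ}

/-- Bounded measurable complex functions, the domain of the Borel functional calculus. -/
structure IsBoundedMeasurable (g : α → ℂ) : Prop where
  measurable : Measurable g
  bounded : ∃ C : ℝ, ∀ t, ‖g t‖ ≤ C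

namespace IsBoundedMeasurable

theorem const (c : ℂ) : IsBoundedMeasurable fun _ : α => c :=
  ⟨measurable_const, ‖c‖, fun _ => le_rfl⟩

theorem add (hg : IsBoundedMeasurable g) (hh : IsBoundedMeasurable h) :
    IsBoundedMeasurable (g + h) := by
  obtain ⟨C, hC⟩ := hg.bounded
  obtain ⟨D, hD⟩ := hh.bounded
  exact ⟨hg.measurable.add hh.measurable, C + D, fun t => norm_add_le_of_le (hC t) (hD t)⟩

theorem mul (hg : IsBoundedMeasurable g) (hh : IsBoundedMeasurable h) :
    IsBoundedMeasurable (g * h) := by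
  obtain ⟨C, hC⟩ := hg.bounded
  obtain ⟨D, hD⟩ := hh.bounded
  exact ⟨hg.measurable.mul hh.measurable, C * D, fun t => norm_mul_le_of_le (hC t) (hD t)⟩

theorem const_smul (c : ℂ) (hg : IsBoundedMeasurable g) : IsBoundedMeasurable (c • g) :=
  (const c).mul hg

theorem star (hg : IsBoundedMeasurable g) : IsBoundedMeasurable (star g) := by
  obtain ⟨C, hC⟩ := hg.bounded
  exact ⟨hg.measurable.stronglyMeasurable.star.measurable, C, fun t => by simpa using hC t⟩

theorem indicator_one {B : Set α} (hB : MeasurableSet B) :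
    IsBoundedMeasurable (B.indicator fun _ => 1) :=
  ⟨measurable_const.indicator hB, 1, fun t => by
    simpa using norm_indicator_le_norm_self (fun _ => (1 : ℂ)) t⟩

theorem prod {ι : Type*} {g : ι → α → ℂ} (hg : ∀ i, IsBoundedMeasurable (g i)) (s : Finset ι) :
    IsBoundedMeasurable (∏ i ∈ s, g i) :=
  Finset.prod_induction g _ (fun _ _ => mul) (const 1) fun i _ => hg i

theorem integrable (hg : IsBoundedMeasurable g) (μ : Measure α) [IsFiniteMeasure μ] :
    Integrable g μ := by
  obtain ⟨C, hC⟩ := hg.bounded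
  exact .of_bound hg.measurable.aestronglyMeasurable C (.of_forall hC)

end IsBoundedMeasurable

/-- A class of functions to which the functional monotone class theorem applies: it contains the
bounded continuous real functions and is stable, within the bounded measurable functions, under
linear combinations and uniformly bounded pointwise limits. -/
structure IsMonotoneClass [TopologicalSpace α] (P : (α → ℂ) → Prop) : Prop where
  of_continuous : ∀ f : C(α, ℝ), IsBoundedMeasurable (fun t => (f t : ℂ)) → P fun t => (f t : ℂ)
  add : ∀ f g, IsBoundedMeasurable f → IsBoundedMeasurable g → P f → P g → P (f + g)
  const_smul : ∀ (c : ℂ) g, IsBoundedMeasurable g → P g → P (c • g)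
  of_tendsto : ∀ (f : ℕ → α → ℂ) (g : α → ℂ) (C : ℝ), (∀ n, IsBoundedMeasurable (f n)) →
    (∀ n t, ‖f n t‖ ≤ C) → (∀ t, Tendsto (fun n => f n t) atTop (𝓝 (g t))) →
    (∀ n, P (f n)) → P g

namespace IsMonotoneClass

variable [TopologicalSpace α] {P : (α → ℂ) → Prop}

theorem const (hP : IsMonotoneClass P) (c : ℂ) : P fun _ => c := by
  have h := hP.const_smul c _ (.const 1)
    (by simpa using hP.of_continuous 1 (by simpa using .const 1))
  simpa [Pi.smul_def] using h

theorem indicator_isClosed [OpensMeasurableSpace α] [HasOuterApproxClosed α]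
    (hP : IsMonotoneClass P) {F : Set α} (hF : IsClosed F) : P (F.indicator fun _ => 1) := by
  let f n : C(α, ℝ) := ⟨fun t => hF.apprSeq n t, by fun_prop⟩
  have hf1 n t : ‖(f n t : ℂ)‖ ≤ 1 := by
    simpa [f] using HasOuterApproxClosed.apprSeq_apply_le_one hF n t
  have hf n : IsBoundedMeasurable fun t => (f n t : ℂ) := ⟨by fun_prop, 1, hf1 n⟩
  refine hP.of_tendsto _ _ 1 hf hf1 (fun t => ?_) fun n => hP.of_continuous (f n) (hf n)
  have h := tendsto_pi_nhds.1 (HasOuterApproxClosed.tendsto_apprSeq hF) t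
  have hc : Continuous fun x : ℝ≥0 => ((x : ℝ) : ℂ) := by fun_prop
  have hF1 : F.indicator (fun _ => (1 : ℂ)) t =
      (((F.indicator (fun _ => (1 : ℝ≥0)) t : ℝ≥0) : ℝ) : ℂ) := by
    by_cases ht : t ∈ F <;> simp [ht]
  rw [hF1]
  exact (hc.tendsto _).comp h

theorem sum (hP : IsMonotoneClass P) {ι : Type*} {f : ι → α → ℂ} (s : Finset ι)
    (hf : ∀ i, IsBoundedMeasurable (f i)) (hfP : ∀ i, P (f i)) : P (∑ i ∈ s, f i) :=
  (Finset.sum_induction f (fun g => IsBoundedMeasurable g ∧ P g)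
    (fun _ _ hg hh => ⟨hg.1.add hh.1, hP.add _ _ hg.1 hh.1 hg.2 hh.2⟩)
    ⟨.const 0, hP.const 0⟩ fun i _ => ⟨hf i, hfP i⟩).2

theorem indicator_one [BorelSpace α] [HasOuterApproxClosed α] (hP : IsMonotoneClass P) {B : Set α}
    (hB : MeasurableSet B) : P (B.indicator fun _ => 1) := by
  refine MeasurableSpace.induction_on_inter (C := fun B _ => P (B.indicator fun _ => 1))
    (BorelSpace.measurable_eq.trans borel_eq_generateFrom_isClosed) isPiSystem_isClosed
    (by simpa using hP.const 0) (fun F hF => hP.indicator_isClosed hF) (fun B hB hBP => ?compl)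
    (fun B hd hB hBP => ?iUnion) B hB
  case compl =>
    have h := hP.add _ _ (.const 1) ((IsBoundedMeasurable.indicator_one hB).const_smul (-1))
      (hP.const 1) (hP.const_smul (-1) _ (.indicator_one hB) hBP)
    convert h using 1
    ext t
    by_cases ht : t ∈ B <;> simp [ht]
  case iUnion =>
    have hU (n : ℕ) : ∑ i ∈ Finset.range n, (B i).indicator (fun _ => (1 : ℂ)) =
        (⋃ i ∈ Finset.range n, B i).indicator fun _ => 1 := by
      rw [Finset.indicator_biUnion _ _ fun i _ j _ hij => hd hij]
      exact Finset.sum_fn _ _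
    refine hP.of_tendsto (fun n => (⋃ i ∈ Finset.range n, B i).indicator fun _ => 1) _ 1
      (fun n => .indicator_one (.biUnion (Finset.countable_toSet _) fun i _ => hB i))
      (fun n t => by simpa using norm_indicator_le_norm_self (fun _ => (1 : ℂ)) t) (fun t => ?_)
      fun n => hU n ▸ hP.sum _ (fun i => .indicator_one (hB i)) hBP
    exact (tendsto_indicator_biUnion_finset B _ t).mono_right (pure_le_nhds _)
      |>.comp tendsto_finset_range

theorem of_isBoundedMeasurable [BorelSpace α] [HasOuterApproxClosed α] (hP : IsMonotoneClass P)
    (hg : IsBoundedMeasurable g) : P g := by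
  obtain ⟨C, hC⟩ := hg.bounded
  have hs := hg.measurable.stronglyMeasurable
  have bm (f : SimpleFunc α ℂ) : IsBoundedMeasurable f := ⟨f.measurable, f.exists_forall_norm_le⟩
  have simple (f : SimpleFunc α ℂ) : P f := by
    induction f using SimpleFunc.induction with
    | @const c s hB =>
      convert hP.const_smul c _ (.indicator_one hB) (hP.indicator_one hB) using 1
      ext t
      by_cases ht : t ∈ s <;> simp [ht]
    | add _ hf hg => exact hP.add _ _ (bm _) (bm _) hf hg
  exact hP.of_tendsto (fun n => hs.approxBounded C n) g C (fun n => bm _)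
    (fun n t => hs.norm_approxBounded_le ((norm_nonneg _).trans (hC t)) n t)
    (fun t => hs.tendsto_approxBounded_of_norm_le (hC t)) fun n => simple _

end IsMonotoneClass

end BoundedMeasurable

section BorelCalculus

variable {H : Type*} [NormedAddCommGroup H] [InnerProductSpace ℂ H]

theorem tendsto_inner_of_tendsto_inner_self {ι : Type*} {l : Filter ι} {T : ι → H →L[ℂ] H}
    {S : H →L[ℂ] H} (h : ∀ x, Tendsto (fun i => ⟪x, T i x⟫_ℂ) l (𝓝 ⟪x, S x⟫_ℂ)) (x y : H) :
    Tendsto (fun i => ⟪x, T i y⟫_ℂ) l (𝓝 ⟪x, S y⟫_ℂ) := by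
  have hconj (x : H) : Tendsto (fun i => ⟪T i x, x⟫_ℂ) l (𝓝 ⟪S x, x⟫_ℂ) := by
    simpa only [← starRingEnd_apply, inner_conj_symm] using (h x).star
  suffices Tendsto (fun i => ⟪T i y, x⟫_ℂ) l (𝓝 ⟪S y, x⟫_ℂ) by
    simpa using this.star
  have hT (R : H →L[ℂ] H) := inner_map_polarization (R : H →ₗ[ℂ] H) x y
  simp only [ContinuousLinearMap.coe_coe] at hT
  simp only [hT]
  exact ((((hconj _).sub (hconj _)).add ((hconj _).const_mul _)).sub
    ((hconj _).const_mul _)).div_const _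

variable [CompleteSpace H] (N : H →L[ℂ] H) (hN : IsSelfAdjoint N) {g h : ℝ → ℂ}

theorem inner_borelCalculus_self (hg : IsBoundedMeasurable g) (x : H) :
    ⟪x, borelCalculus N hN g x⟫_ℂ = ∫ t, g t ∂vectorSpectralMeasure N hN x :=
  inner_borelCalculus N hN hg.measurable hg.bounded.choose_spec x

variable {N hN}

theorem borelCalculus_eq (hg : IsBoundedMeasurable g) {A : H →L[ℂ] H}
    (h : ∀ x, ⟪x, A x⟫_ℂ = ∫ t, g t ∂vectorSpectralMeasure N hN x) :
    borelCalculus N hN g = A := by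
  refine ContinuousLinearMap.coe_injective ((ext_inner_map _ _).1 fun x => ?_)
  rw [← inner_conj_symm, ← inner_conj_symm (A.toLinearMap x)]
  exact congrArg _ ((inner_borelCalculus_self N hN hg x).trans (h x).symm)

variable (N hN)

theorem borelCalculus_add (hg : IsBoundedMeasurable g) (hh : IsBoundedMeasurable h) :
    borelCalculus N hN (g + h) = borelCalculus N hN g + borelCalculus N hN h := by
  refine borelCalculus_eq (hg.add hh) fun x => ?_
  simp only [Pi.add_apply]
  rw [integral_add (hg.integrable _) (hh.integrable _), add_apply, inner_add_right,
    inner_borelCalculus_self N hN hg, inner_borelCalculus_self N hN hh]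

theorem borelCalculus_smul (c : ℂ) (hg : IsBoundedMeasurable g) :
    borelCalculus N hN (c • g) = c • borelCalculus N hN g := by
  refine borelCalculus_eq (hg.const_smul c) fun x => ?_
  simp only [Pi.smul_apply]
  rw [integral_smul, smul_apply, inner_smul_right, inner_borelCalculus_self N hN hg, smul_eq_mul]

theorem borelCalculus_one : borelCalculus N hN 1 = 1 := by
  refine borelCalculus_eq (.const 1) fun x => ?_
  simp [measureReal_vectorSpectralMeasure_univ, inner_self_eq_norm_sq_to_K]

theorem adjoint_borelCalculus (hg : IsBoundedMeasurable g) :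
    ContinuousLinearMap.adjoint (borelCalculus N hN g) = borelCalculus N hN (star g) := by
  refine (borelCalculus_eq hg.star fun x => ?_).symm
  rw [ContinuousLinearMap.adjoint_inner_right, ← inner_conj_symm, inner_borelCalculus_self N hN hg]
  exact integral_conj.symm

theorem borelCalculus_ofReal (f : C(ℝ, ℝ)) (hf : IsBoundedMeasurable fun t => (f t : ℂ)) :
    borelCalculus N hN (fun t => (f t : ℂ)) = cfcHom hN (f.restrict (spectrum ℝ N)) := by
  refine borelCalculus_eq hf fun x => ?_
  have hsa : IsSelfAdjoint (cfcHom hN (f.restrict (spectrum ℝ N))) := cfcHom_predicate hN _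
  rw [integral_complex_ofReal, integral_vectorSpectralMeasure]
  refine (Complex.conj_eq_iff_re.1 ?_).symm
  rw [inner_conj_symm]
  exact hsa.isSymmetric x x

theorem tendsto_inner_borelCalculus {f : ℕ → ℝ → ℂ} {C : ℝ}
    (hf : ∀ n, IsBoundedMeasurable (f n)) (hC : ∀ n t, ‖f n t‖ ≤ C)
    (hlim : ∀ t, Tendsto (fun n => f n t) atTop (𝓝 (g t))) (x y : H) :
    Tendsto (fun n => ⟪x, borelCalculus N hN (f n) y⟫_ℂ) atTop
      (𝓝 ⟪x, borelCalculus N hN g y⟫_ℂ) := by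
  have hg : IsBoundedMeasurable g :=
    ⟨measurable_of_tendsto_metrizable (fun n => (hf n).measurable) (tendsto_pi_nhds.2 hlim), C,
      fun t => le_of_tendsto (hlim t).norm (.of_forall fun n => hC n t)⟩
  refine tendsto_inner_of_tendsto_inner_self (fun x => ?_) x y
  simp only [inner_borelCalculus_self N hN (hf _), inner_borelCalculus_self N hN hg]
  exact tendsto_integral_of_dominated_convergence (fun _ => C)
    (fun n => (hf n).measurable.aestronglyMeasurable) (integrable_const C)
    (fun n => .of_forall (hC n)) (.of_forall hlim)

theorem isMonotoneClass_borelCalculus_mul (hh : IsBoundedMeasurable h) (A B : H →L[ℂ] H)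
    (hcont : ∀ f : C(ℝ, ℝ), IsBoundedMeasurable (fun t => (f t : ℂ)) →
      borelCalculus N hN ((fun t => (f t : ℂ)) * h) = A * borelCalculus N hN (fun t => f t) * B) :
    IsMonotoneClass fun g => borelCalculus N hN (g * h) = A * borelCalculus N hN g * B where
  of_continuous := hcont
  add f g hf hg hfP hgP := by
    rw [add_mul, borelCalculus_add N hN (hf.mul hh) (hg.mul hh), hfP, hgP,
      borelCalculus_add N hN hf hg, mul_add, add_mul]
  const_smul c g hg hgP := by
    rw [smul_mul_assoc, borelCalculus_smul N hN c (hg.mul hh), hgP, borelCalculus_smul N hN c hg,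
      mul_smul_comm, smul_mul_assoc]
  of_tendsto f g C hf hC hlim hfP := by
    obtain ⟨D, hD⟩ := hh.bounded
    ext y
    refine ext_inner_left ℂ fun x => ?_
    have hl := tendsto_inner_borelCalculus N hN (C := C * D) (fun n => (hf n).mul hh)
      (fun n t => norm_mul_le_of_le (hC n t) (hD t)) (fun t => (hlim t).mul_const (h t)) x y
    have hr := tendsto_inner_borelCalculus N hN hf hC hlim (ContinuousLinearMap.adjoint A x) (B y)
    simp only [hfP, mul_apply_eq_comp, ContinuousLinearMap.adjoint_inner_left] at hl hr
    exact tendsto_nhds_unique hl hr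

theorem borelCalculus_mul_ofReal (f : C(ℝ, ℝ)) (hf : IsBoundedMeasurable fun t => (f t : ℂ))
    (hg : IsBoundedMeasurable g) : borelCalculus N hN (g * fun t => (f t : ℂ)) =
      borelCalculus N hN (fun t => f t) * borelCalculus N hN g := by
  refine ((isMonotoneClass_borelCalculus_mul N hN hf (borelCalculus N hN fun t => f t) 1
    fun f' hf' => ?_).of_isBoundedMeasurable hg).trans (mul_one _)
  have hff' : (fun t => ((f' * f) t : ℂ)) = (fun t => (f' t : ℂ)) * fun t => (f t : ℂ) := by
    ext t
    simp
  have hcfc := borelCalculus_ofReal N hN (f' * f) (hff' ▸ hf'.mul hf)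
  rw [hff', mul_comm f' f] at hcfc
  rw [mul_one, borelCalculus_ofReal N hN f hf, borelCalculus_ofReal N hN f' hf', hcfc, ← map_mul]
  rfl

theorem borelCalculus_mul (hg : IsBoundedMeasurable g) (hh : IsBoundedMeasurable h) :
    borelCalculus N hN (g * h) = borelCalculus N hN g * borelCalculus N hN h := by
  rw [← one_mul (borelCalculus N hN g)]
  refine (isMonotoneClass_borelCalculus_mul N hN hh 1 _ fun f hf => ?_).of_isBoundedMeasurable hg
  rw [one_mul, mul_comm, borelCalculus_mul_ofReal N hN f hf hh]

theorem vectorSpectralMeasure_compl_spectrum (x : H) :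
    vectorSpectralMeasure N hN x (spectrum ℝ N)ᶜ = 0 := by
  rw [vectorSpectralMeasure, Measure.map_apply measurable_subtype_coe
    (spectrum.isClosed N).measurableSet.compl, Set.preimage_compl, Subtype.coe_preimage_self,
    Set.compl_univ, measure_empty]

theorem spectralProjection_compl_spectrum :
    spectralProjection N hN (spectrum ℝ N)ᶜ = 0 := by
  have hB : MeasurableSet (spectrum ℝ N)ᶜ := (spectrum.isClosed N).measurableSet.compl
  refine borelCalculus_eq (.indicator_one hB) fun x => ?_
  rw [integral_indicator_const _ hB, measureReal_def, vectorSpectralMeasure_compl_spectrum]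
  simp

end BorelCalculus

section Trace

section HilbertSchmidt

variable {𝕜 E ι κ : Type*} [RCLike 𝕜] [NormedAddCommGroup E] [InnerProductSpace 𝕜 E]

theorem hasSum_norm_inner_sq (b : HilbertBasis ι 𝕜 E) (v : E) :
    HasSum (fun i => ‖inner 𝕜 (b i) v‖ ^ 2) (‖v‖ ^ 2) := by
  have h := RCLike.hasSum_re 𝕜 (b.hasSum_inner_mul_inner v v)
  rw [inner_self_eq_norm_sq] at h
  refine h.congr_fun fun i => ?_
  rw [← inner_conj_symm, RCLike.norm_conj, RCLike.mul_conj, ← RCLike.ofReal_pow, RCLike.ofReal_re]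

theorem summable_norm_inner_sq (b : HilbertBasis ι 𝕜 E) {v : κ → E}
    (hv : Summable fun j => ‖v j‖ ^ 2) :
    Summable fun p : κ × ι => ‖inner 𝕜 (b p.2) (v p.1)‖ ^ 2 := by
  refine (summable_prod_of_nonneg fun p => sq_nonneg _).2
    ⟨fun j => (hasSum_norm_inner_sq b (v j)).summable, ?_⟩
  have hrow j : ∑' i, ‖inner 𝕜 (b i) (v j)‖ ^ 2 = ‖v j‖ ^ 2 := (hasSum_norm_inner_sq b _).tsum_eq
  simpa only [hrow] using hv

variable {F : Type*} [NormedAddCommGroup F] [InnerProductSpace 𝕜 F]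

/-- The two sides are the Hilbert–Schmidt inner products of `S` with `R` and of `R†` with `S†`. -/
theorem tsum_inner_eq_tsum_inner_adjoint [CompleteSpace E] [CompleteSpace F]
    (b : HilbertBasis ι 𝕜 E) (c : HilbertBasis κ 𝕜 F) {S R : E →L[𝕜] F}
    (hS : Summable fun i => ‖S (b i)‖ ^ 2) (hR : Summable fun i => ‖R (b i)‖ ^ 2) :
    ∑' i, inner 𝕜 (S (b i)) (R (b i)) = ∑' j, inner 𝕜 (R.adjoint (c j)) (S.adjoint (c j)) := by
  have hsum : Summable fun p : ι × κ =>
      inner 𝕜 (S (b p.1)) (c p.2) * inner 𝕜 (c p.2) (R (b p.1)) := by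
    refine .of_norm_bounded (((summable_norm_inner_sq c hS).add
      (summable_norm_inner_sq c hR)).mul_left (1 / 2)) fun p => ?_
    rw [norm_mul, norm_inner_symm (S (b p.1)) (c p.2)]
    nlinarith [sq_nonneg (‖inner 𝕜 (c p.2) (S (b p.1))‖ - ‖inner 𝕜 (c p.2) (R (b p.1))‖)]
  have hrow i : HasSum (fun j => inner 𝕜 (S (b i)) (c j) * inner 𝕜 (c j) (R (b i)))
      (inner 𝕜 (S (b i)) (R (b i))) := c.hasSum_inner_mul_inner _ _
  have hcol j : HasSum (fun i => inner 𝕜 (S (b i)) (c j) * inner 𝕜 (c j) (R (b i)))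
      (inner 𝕜 (R.adjoint (c j)) (S.adjoint (c j))) := by
    simpa only [ContinuousLinearMap.adjoint_inner_left, ContinuousLinearMap.adjoint_inner_right,
      mul_comm] using b.hasSum_inner_mul_inner (R.adjoint (c j)) (S.adjoint (c j))
  exact (hsum.hasSum.prod_fiberwise hrow).tsum_eq.trans
    (((Equiv.prodComm κ ι).hasSum_iff.2 hsum.hasSum).prod_fiberwise hcol).tsum_eq.symm

end HilbertSchmidt

variable {H : Type*} [NormedAddCommGroup H] [InnerProductSpace ℂ H] [CompleteSpace H]

theorem trace_smul (c : ℂ) (A : H →L[ℂ] H) : trace (c • A) = c * trace A := by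
  simp [trace, tsum_mul_left]

theorem trace_mul_mul_adjoint {ρ : H →L[ℂ] H} (hρ : IsDensityMatrix ρ) (A B : H →L[ℂ] H) :
    trace (B * (A * ρ * A.adjoint)) = trace (A.adjoint * B * A * ρ) := by
  have hρ0 : 0 ≤ ρ := (ContinuousLinearMap.nonneg_iff_isPositive _).2 hρ.isPositive
  set T := CFC.sqrt ρ
  have hTT : T * T = ρ := CFC.sqrt_mul_sqrt_self ρ hρ0
  have hT : T.adjoint = T := IsSelfAdjoint.of_nonneg (CFC.sqrt_nonneg ρ)
  obtain ⟨hsum, htr⟩ := hasSum_trace_mul hρ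
  have hHS (R : H →L[ℂ] H) : Summable fun j => ‖(R * T) (onBasis H j)‖ ^ 2 := by
    refine .of_nonneg_of_le (fun _ => sq_nonneg _) (fun j => ?_) (hsum.summable.mul_left (‖R‖ ^ 2))
    rw [← mul_pow]
    gcongr
    exact R.le_opNorm _
  have h := tsum_inner_eq_tsum_inner_adjoint (onBasis H) (onBasis H) (hHS A) (hHS (B * A))
  have hleft (i) : inner ℂ ((A * T) (onBasis H i)) ((B * A * T) (onBasis H i)) =
      inner ℂ (T (onBasis H i)) ((A.adjoint * B * A) (T (onBasis H i))) := by
    simp only [mul_apply_eq_comp, ContinuousLinearMap.adjoint_inner_right]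
  have hright (i) : inner ℂ ((B * A * T).adjoint (onBasis H i)) ((A * T).adjoint (onBasis H i)) =
      inner ℂ (onBasis H i) ((B * (A * ρ * A.adjoint)) (onBasis H i)) := by
    rw [ContinuousLinearMap.adjoint_inner_left, ← hTT, ← ContinuousLinearMap.star_eq_adjoint,
      star_mul, ContinuousLinearMap.star_eq_adjoint, ContinuousLinearMap.star_eq_adjoint, hT]
    rfl
  simp only [hleft, hright] at h
  rw [← (htr _).tsum_eq, h, trace]

end Trace

section SpectralMeasure

variable {H : Type*} [NormedAddCommGroup H] [InnerProductSpace ℂ H] [CompleteSpace H]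
  {N : H →L[ℂ] H} (hN : IsSelfAdjoint N) {ρ : H →L[ℂ] H}

theorem isSpectralMeasure_stateSpectralMeasure (hρ : IsDensityMatrix ρ) :
    IsSpectralMeasure N hN ρ (stateSpectralMeasure N hN ρ) := by
  have h := exists_isSpectralMeasure N hN hρ
  rw [stateSpectralMeasure, dif_pos h]
  exact h.choose_spec

theorem trace_borelCalculus_mul (hρ : IsDensityMatrix ρ) {g : ℝ → ℂ} (hg : IsBoundedMeasurable g) :
    trace (borelCalculus N hN g * ρ) = ∫ ν, g ν ∂stateSpectralMeasure N hN ρ :=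
  (isSpectralMeasure_stateSpectralMeasure hN hρ).2 g hg.measurable hg.bounded

theorem spectralProjection_univ : spectralProjection N hN Set.univ = 1 := by
  rw [spectralProjection, Set.indicator_univ]
  exact borelCalculus_one N hN

theorem trace_spectralProjection_mul (hρ : IsDensityMatrix ρ) {B : Set ℝ} (hB : MeasurableSet B) :
    trace (spectralProjection N hN B * ρ) = ((stateSpectralMeasure N hN ρ).real B : ℂ) := by
  rw [spectralProjection, trace_borelCalculus_mul hN hρ (.indicator_one hB),
    integral_indicator_const _ hB]
  simp

theorem isProbabilityMeasure_stateSpectralMeasure (hρ : IsDensityMatrix ρ) :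
    IsProbabilityMeasure (stateSpectralMeasure N hN ρ) := by
  have := (isSpectralMeasure_stateSpectralMeasure hN hρ).1
  have h := trace_spectralProjection_mul hN hρ MeasurableSet.univ
  rw [spectralProjection_univ, one_mul, trace, hρ.hasSum_one.tsum_eq] at h
  have hreal : (stateSpectralMeasure N hN ρ).real Set.univ = 1 := mod_cast h.symm
  exact ⟨by rw [← ofReal_measureReal, hreal, ENNReal.ofReal_one]⟩

theorem ae_mem_spectrum (hρ : IsDensityMatrix ρ) :
    ∀ᵐ ν ∂stateSpectralMeasure N hN ρ, ν ∈ spectrum ℝ N := by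
  have := isProbabilityMeasure_stateSpectralMeasure hN hρ
  have h := trace_spectralProjection_mul hN hρ (spectrum.isClosed (𝕜 := ℝ) N).measurableSet.compl
  rw [spectralProjection_compl_spectrum, zero_mul, ← zero_smul ℂ (0 : H →L[ℂ] H), trace_smul,
    zero_mul, eq_comm, Complex.ofReal_eq_zero, measureReal_eq_zero_iff] at h
  exact h

end SpectralMeasure

section Posterior

variable {H : Type*} [NormedAddCommGroup H] [InnerProductSpace ℂ H] [CompleteSpace H]
  {X : Type*} [MeasurableSpace X] {N : H →L[ℂ] H} (hN : IsSelfAdjoint N) {ρ : H →L[ℂ] H}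
  {μ : Measure X} {V : X → ℝ → ℂ}

theorem IsJumpFamily.isBoundedMeasurable (hV : IsJumpFamily μ V) (ξ : X) :
    IsBoundedMeasurable (V ξ) :=
  ⟨hV.measurable.comp measurable_prodMk_left, hV.bounded ξ⟩

theorem jumpProduct_eq (hV : IsJumpFamily μ V) {k : ℕ} (ξ : Fin k → X) :
    jumpProduct N hN V ξ = borelCalculus N hN (∏ i, V (ξ i)) := by
  induction k with
  | zero => simp [jumpProduct, borelCalculus_one]
  | succ k ih =>
    have hprod : IsBoundedMeasurable (∏ i : Fin k, V (ξ i.castSucc)) :=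
      .prod (fun i => hV.isBoundedMeasurable _) _
    rw [Fin.prod_univ_castSucc, mul_comm, borelCalculus_mul N hN (hV.isBoundedMeasurable _) hprod,
      ← ih fun i => ξ i.castSucc]
    simp only [jumpProduct]
    rw [List.ofFn_succ', List.concat_eq_append, List.reverse_append, List.prod_append,
      List.reverse_singleton, List.prod_singleton]

theorem trace_spectralProjection_mul_unnormalizedPosterior (hV : IsJumpFamily μ V)
    (hρ : IsDensityMatrix ρ) {k : ℕ} (ξ : Fin k → X) {B : Set ℝ} (hB : MeasurableSet B) :
    trace (spectralProjection N hN B * unnormalizedPosterior N hN V ρ ξ) =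
      ((∫ ν in B, ∏ i, likelihood V (ξ i) ν ∂stateSpectralMeasure N hN ρ : ℝ) : ℂ) := by
  have hv : IsBoundedMeasurable (∏ i, V (ξ i)) := .prod (fun i => hV.isBoundedMeasurable _) _
  have hb : IsBoundedMeasurable (B.indicator fun _ => 1) := .indicator_one hB
  rw [unnormalizedPosterior, trace_mul_mul_adjoint hρ, jumpProduct_eq hN hV,
    adjoint_borelCalculus N hN hv, spectralProjection, ← borelCalculus_mul N hN hv.star hb,
    ← borelCalculus_mul N hN (hv.star.mul hb) hv,
    trace_borelCalculus_mul hN hρ ((hv.star.mul hb).mul hv), ← integral_indicator hB,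
    ← integral_complex_ofReal]
  refine integral_congr_ae (.of_forall fun ν => ?_)
  by_cases hν : ν ∈ B
  · simp only [Pi.mul_apply, Pi.star_apply, Finset.prod_apply, Set.indicator_of_mem hν, mul_one,
      likelihood, Finset.prod_pow, ← norm_prod]
    rw [RCLike.star_def, RCLike.conj_mul]
    norm_cast
  · simp [hν]

theorem trace_unnormalizedPosterior (hV : IsJumpFamily μ V) (hρ : IsDensityMatrix ρ) {k : ℕ}
    (ξ : Fin k → X) : trace (unnormalizedPosterior N hN V ρ ξ) =
      ((∫ ν, ∏ i, likelihood V (ξ i) ν ∂stateSpectralMeasure N hN ρ : ℝ) : ℂ) := by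
  simpa only [spectralProjection_univ, one_mul, Measure.restrict_univ] using
    trace_spectralProjection_mul_unnormalizedPosterior hN hV hρ ξ MeasurableSet.univ

/-- The posterior probability that `ν ∈ B` after the first `k` outcomes, for the prior `m` and the
likelihood `f(ξ|ν)`. -/
noncomputable def posteriorProb (m : Measure ℝ) (V : X → ℝ → ℂ) (B : Set ℝ) (k : ℕ) (ξ : ℕ → X) :
    ℝ :=
  (∫ ν in B, ∏ j ∈ Finset.range k, likelihood V (ξ j) ν ∂m) /
    ∫ ν, ∏ j ∈ Finset.range k, likelihood V (ξ j) ν ∂m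

theorem trace_spectralProjection_mul_posterior (hV : IsJumpFamily μ V) (hρ : IsDensityMatrix ρ)
    (k : ℕ) (ξ : ℕ → X) {B : Set ℝ} (hB : MeasurableSet B) :
    trace (spectralProjection N hN B * posterior N hN V ρ k ξ) =
      (posteriorProb (stateSpectralMeasure N hN ρ) V B k ξ : ℂ) := by
  rw [posterior, mul_smul_comm, trace_smul,
    trace_spectralProjection_mul_unnormalizedPosterior hN hV hρ _ hB,
    trace_unnormalizedPosterior hN hV hρ, inv_mul_eq_div, ← Complex.ofReal_div]
  simp only [posteriorProb, Finset.prod_range]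

end Posterior

section ProductMeasure

theorem lintegral_fin_nat_prod_eq_prod {n : ℕ} {X : Fin n → Type*} [∀ i, MeasurableSpace (X i)]
    (μ : ∀ i, Measure (X i)) [∀ i, SigmaFinite (μ i)] {f : ∀ i, X i → ℝ≥0∞}
    (hf : ∀ i, Measurable (f i)) :
    ∫⁻ x, ∏ i, f i (x i) ∂Measure.pi μ = ∏ i, ∫⁻ y, f i y ∂μ i := by
  induction n with
  | zero => simp
  | succ n ih =>
    have htail : Measurable fun x : ∀ i : Fin n, X i.succ => ∏ i, f i.succ (x i) :=
      Finset.measurable_fun_prod _ fun i _ => (hf _).comp (measurable_pi_apply i)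
    rw [Fin.prod_univ_succ, ← ih (fun i => μ i.succ) fun i => hf i.succ,
      ← lintegral_prod_mul (hf 0).aemeasurable htail.aemeasurable]
    refine .trans ?_ ((measurePreserving_piFinSuccAbove μ 0).lintegral_comp
      (f := fun z => f 0 z.1 * ∏ i : Fin n, f i.succ (z.2 i))
      (((hf 0).comp measurable_fst).mul (htail.comp measurable_snd)))
    simp only [Fin.prod_univ_succ]
    rfl

theorem pi_withDensity {n : ℕ} {X : Fin n → Type*} [∀ i, MeasurableSpace (X i)]
    (μ : ∀ i, Measure (X i)) [∀ i, SigmaFinite (μ i)] {f : ∀ i, X i → ℝ≥0∞}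
    (hf : ∀ i, Measurable (f i)) [∀ i, SigmaFinite ((μ i).withDensity (f i))] :
    Measure.pi (fun i => (μ i).withDensity (f i)) =
      (Measure.pi μ).withDensity fun x => ∏ i, f i (x i) := by
  refine Measure.pi_eq fun s hs => ?_
  rw [withDensity_apply _ (.univ_pi hs), ← lintegral_indicator (.univ_pi hs)]
  simp only [withDensity_apply _ (hs _), ← lintegral_indicator (hs _)]
  rw [← lintegral_fin_nat_prod_eq_prod μ fun i => (hf i).indicator (hs i)]
  congr with x
  by_cases hx : ∀ i, x i ∈ s i
  · simp [hx]
  · obtain ⟨i, hi⟩ := not_forall.1 hx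
    rw [Set.indicator_of_notMem fun h : x ∈ Set.univ.pi s => hx fun i => h i trivial]
    exact (Finset.prod_eq_zero (Finset.mem_univ i) (Set.indicator_of_notMem hi _)).symm

theorem measurable_infinitePi {Θ ι : Type*} {X : ι → Type*} [MeasurableSpace Θ]
    [∀ i, MeasurableSpace (X i)] {m : ∀ i, Θ → Measure (X i)}
    [∀ i θ, IsProbabilityMeasure (m i θ)] (hm : ∀ i, Measurable (m i)) :
    Measurable fun θ => Measure.infinitePi fun i => m i θ := by
  refine .measure_of_isPiSystem_of_isProbabilityMeasure generateFrom_squareCylinders.symm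
    (isPiSystem_squareCylinders (fun i => MeasurableSpace.isPiSystem_measurableSet)
      fun i => .univ) ?_
  rintro _ ⟨s, t, ht, rfl⟩
  have ht' i : MeasurableSet (t i) := ht i (Set.mem_univ i)
  simp only [Measure.infinitePi_pi _ fun i _ => ht' i]
  exact Finset.measurable_fun_prod _ fun i _ => (Measure.measurable_coe (ht' i)).comp (hm i)

variable {X : Type*} [MeasurableSpace X]

theorem measurable_initial (k : ℕ) : Measurable fun (ξ : ℕ → X) (i : Fin k) => ξ i :=
  measurable_pi_lambda _ fun _ => measurable_pi_apply _

theorem map_initial_infinitePi (m : Measure X) [IsProbabilityMeasure m] (k : ℕ) :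
    (Measure.infinitePi fun _ : ℕ => m).map (fun ξ (i : Fin k) => ξ i) =
      Measure.pi fun _ : Fin k => m := by
  rw [← Measure.infinitePi_eq_pi]
  exact Measure.map_infinitePi_infinitePi_of_inj Fin.val_injective

theorem ext_of_map_initial {P Q : Measure (ℕ → X)} [IsFiniteMeasure Q]
    (h : ∀ k, P.map (fun ξ (i : Fin k) => ξ i) = Q.map (fun ξ (i : Fin k) => ξ i)) : P = Q := by
  refine IsProjectiveLimit.unique (P := fun I => Q.map I.restrict) (fun I => ?_) fun I => rfl
  have hI (i : I) : (i : ℕ) < I.sup id + 1 := Nat.lt_succ_of_le (Finset.le_sup (f := id) i.2)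
  have hmeas : Measurable fun (x : Fin (I.sup id + 1) → X) (i : I) => x ⟨i, hI i⟩ :=
    measurable_pi_lambda _ fun _ => measurable_pi_apply _
  have hmap := congrArg (Measure.map fun x (i : I) => x ⟨i, hI i⟩) (h (I.sup id + 1))
  rwa [Measure.map_map hmeas (measurable_initial _),
    Measure.map_map hmeas (measurable_initial _)] at hmap

end ProductMeasure

section OutcomeLaw

open ProbabilityTheory

variable {X : Type*}

theorem likelihood_nonneg (V : X → ℝ → ℂ) (ξ : X) (ν : ℝ) : 0 ≤ likelihood V ξ ν := sq_nonneg _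

variable [MeasurableSpace X] {μ : Measure X} {V : X → ℝ → ℂ}

namespace IsJumpFamily

theorem measurable_likelihood (hV : IsJumpFamily μ V) :
    Measurable fun p : X × ℝ => likelihood V p.1 p.2 :=
  hV.measurable.norm.pow_const 2

theorem measurable_likelihood_left (hV : IsJumpFamily μ V) (ν : ℝ) :
    Measurable fun ξ => likelihood V ξ ν :=
  hV.measurable_likelihood.comp measurable_prodMk_right

theorem measurable_prod_likelihood (hV : IsJumpFamily μ V) (k : ℕ) :
    Measurable fun p : (Fin k → X) × ℝ => ∏ i, likelihood V (p.1 i) p.2 :=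
  Finset.measurable_fun_prod _ fun i _ =>
    hV.measurable_likelihood.comp (f := fun p : (Fin k → X) × ℝ => (p.1 i, p.2))
      (((measurable_pi_apply i).comp measurable_fst).prodMk measurable_snd)

theorem integrable_prod_likelihood (hV : IsJumpFamily μ V) {ι : Type*} (s : Finset ι) (ξ : ι → X)
    (m : Measure ℝ) [IsFiniteMeasure m] :
    Integrable (fun ν => ∏ i ∈ s, likelihood V (ξ i) ν) m := by
  have hv : IsBoundedMeasurable (∏ i ∈ s, V (ξ i)) := .prod (fun i => hV.isBoundedMeasurable _) s
  refine ((hv.mul hv).integrable m).norm.congr (.of_forall fun ν => ?_)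
  simp [likelihood, sq, Finset.prod_mul_distrib]

theorem isProbabilityMeasure_outcomeMeasure (hV : IsJumpFamily μ V) (ν : ℝ) :
    IsProbabilityMeasure (outcomeMeasure μ V ν) :=
  ⟨by rw [outcomeMeasure, withDensity_apply _ .univ, Measure.restrict_univ]
      exact hV.normalized ν⟩

theorem measurable_outcomeMeasure [SigmaFinite μ] (hV : IsJumpFamily μ V) :
    Measurable (outcomeMeasure μ V) :=
  Measure.measurable_of_measurable_coe _ fun s hs => by
    simp only [outcomeMeasure, withDensity_apply _ hs]
    exact hV.measurable_likelihood.ennreal_ofReal.lintegral_prod_left'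

/-- The kernel `ν ↦ μ_ν^{⊗ℕ}`: the law of the outcomes when the observable has the value `ν`. -/
noncomputable def sequenceKernel [SigmaFinite μ] (hV : IsJumpFamily μ V) : Kernel ℝ (ℕ → X) where
  toFun ν := Measure.infinitePi fun _ => outcomeMeasure μ V ν
  measurable' :=
    have := hV.isProbabilityMeasure_outcomeMeasure
    measurable_infinitePi fun _ => hV.measurable_outcomeMeasure

variable [SigmaFinite μ]

theorem sequenceKernel_apply (hV : IsJumpFamily μ V) (ν : ℝ) :
    hV.sequenceKernel ν = Measure.infinitePi fun _ => outcomeMeasure μ V ν := rfl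

instance isMarkovKernel_sequenceKernel (hV : IsJumpFamily μ V) :
    IsMarkovKernel hV.sequenceKernel := by
  have := hV.isProbabilityMeasure_outcomeMeasure
  exact ⟨fun ν => by rw [sequenceKernel_apply]; infer_instance⟩

theorem map_initial_sequenceKernel (hV : IsJumpFamily μ V) (ν : ℝ) (k : ℕ) :
    (hV.sequenceKernel ν).map (fun ξ (i : Fin k) => ξ i) =
      (Measure.pi fun _ : Fin k => μ).withDensity
        fun ξ => ENNReal.ofReal (∏ i, likelihood V (ξ i) ν) := by
  have := hV.isProbabilityMeasure_outcomeMeasure ν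
  have : SigmaFinite (μ.withDensity fun ξ => ENNReal.ofReal (likelihood V ξ ν)) :=
    inferInstanceAs (SigmaFinite (outcomeMeasure μ V ν))
  simp only [ENNReal.ofReal_prod_of_nonneg fun _ _ => likelihood_nonneg V _ ν]
  rw [sequenceKernel_apply, map_initial_infinitePi,
    ← pi_withDensity _ fun _ => (hV.measurable_likelihood_left ν).ennreal_ofReal]
  rfl

end IsJumpFamily

variable [SigmaFinite μ] {H : Type*} [NormedAddCommGroup H] [InnerProductSpace ℂ H]
  [CompleteSpace H] {N : H →L[ℂ] H} (hN : IsSelfAdjoint N) {ρ : H →L[ℂ] H}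

theorem isOutcomeLaw_comp (hV : IsJumpFamily μ V) (hρ : IsDensityMatrix ρ) :
    IsOutcomeLaw N hN μ V ρ (hV.sequenceKernel ∘ₘ stateSpectralMeasure N hN ρ) := by
  intro k E hE
  have := isProbabilityMeasure_stateSpectralMeasure hN hρ
  calc (hV.sequenceKernel ∘ₘ stateSpectralMeasure N hN ρ) {ξ | (fun i : Fin k => ξ i) ∈ E}
    _ = ∫⁻ ν, hV.sequenceKernel ν ((fun ξ (i : Fin k) => ξ i) ⁻¹' E)
          ∂stateSpectralMeasure N hN ρ :=
        Measure.bind_apply (measurable_initial k hE) hV.sequenceKernel.aemeasurable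
    _ = ∫⁻ ν, ∫⁻ ξ in E, ENNReal.ofReal (∏ i, likelihood V (ξ i) ν) ∂(Measure.pi fun _ => μ)
          ∂stateSpectralMeasure N hN ρ := by
        simp only [← Measure.map_apply (measurable_initial k) hE, hV.map_initial_sequenceKernel,
          withDensity_apply _ hE]
    _ = ∫⁻ ξ in E, ∫⁻ ν, ENNReal.ofReal (∏ i, likelihood V (ξ i) ν) ∂stateSpectralMeasure N hN ρ
          ∂(Measure.pi fun _ => μ) :=
        lintegral_lintegral_swap
          ((hV.measurable_prod_likelihood k).comp measurable_swap).ennreal_ofReal.aemeasurable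
    _ = _ := by
        refine lintegral_congr fun ξ => ?_
        rw [trace_unnormalizedPosterior hN hV hρ, Complex.ofReal_re,
          ofReal_integral_eq_lintegral_ofReal (hV.integrable_prod_likelihood _ ξ _)
            (.of_forall fun ν => Finset.prod_nonneg fun i _ => likelihood_nonneg V _ ν)]

theorem isOutcomeLaw_outcomeLaw (hV : IsJumpFamily μ V) (hρ : IsDensityMatrix ρ) :
    IsOutcomeLaw N hN μ V ρ (outcomeLaw N hN μ V ρ) := by
  have h : ∃ P, IsOutcomeLaw N hN μ V ρ P := ⟨_, isOutcomeLaw_comp hN hV hρ⟩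
  rw [outcomeLaw, dif_pos h]
  exact h.choose_spec

theorem IsOutcomeLaw.unique {P Q : Measure (ℕ → X)} [IsFiniteMeasure Q]
    (hP : IsOutcomeLaw N hN μ V ρ P) (hQ : IsOutcomeLaw N hN μ V ρ Q) : P = Q :=
  ext_of_map_initial fun k => Measure.ext fun E hE => by
    rw [Measure.map_apply (measurable_initial k) hE, Measure.map_apply (measurable_initial k) hE]
    exact (hP k E hE).trans (hQ k E hE).symm

/-- Conditionally on the value of the observable, the outcomes are independent and identically
distributed. -/
theorem outcomeLaw_eq_comp (hV : IsJumpFamily μ V) (hρ : IsDensityMatrix ρ) :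
    outcomeLaw N hN μ V ρ = hV.sequenceKernel ∘ₘ stateSpectralMeasure N hN ρ :=
  have := isProbabilityMeasure_stateSpectralMeasure hN hρ
  (isOutcomeLaw_outcomeLaw hN hV hρ).unique hN (isOutcomeLaw_comp hN hV hρ)

end OutcomeLaw

section Laplace

variable {α : Type*} [MeasurableSpace α] [TopologicalSpace α] {m : Measure α} [IsFiniteMeasure m]
  {C : Set α} {F : ℕ → α → ℝ} {h : α → ℝ} {a : ℝ} {y : α}

omit [TopologicalSpace α] in
theorem eventually_inv_mul_log_integral_exp_lt [NeZero m] (hmC : ∀ᵐ x ∂m, x ∈ C)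
    (hF : TendstoUniformlyOn F h atTop C) {b : ℝ} (hle : ∀ x ∈ C, h x ≤ b) (hba : b < a)
    (hint : ∀ k : ℕ, Integrable (fun x => Real.exp (k * F k x)) m) :
    ∀ᶠ k : ℕ in atTop, (k : ℝ)⁻¹ * Real.log (∫ x, Real.exp (k * F k x) ∂m) < a := by
  obtain ⟨c, hbc, hca⟩ := exists_between hba
  have hm : 0 < m.real Set.univ := measureReal_univ_pos
  filter_upwards [Metric.tendstoUniformlyOn_iff.1 hF (c - b) (sub_pos.2 hbc),
    (tendsto_const_div_atTop_nhds_zero_nat (Real.log (m.real Set.univ))).eventually_lt_const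
      (sub_pos.2 hca), eventually_gt_atTop 0] with k hFk hlog hk
  have hk : (0 : ℝ) < k := Nat.cast_pos.2 hk
  have hFc : ∀ x ∈ C, F k x ≤ c := fun x hx => by
    linarith [hle x hx, (abs_lt.1 (hFk x hx)).1]
  have hub : ∫ x, Real.exp (k * F k x) ∂m ≤ m.real Set.univ * Real.exp (k * c) := by
    refine (integral_mono_ae (hint k) (integrable_const (Real.exp (k * c))) ?_).trans_eq (by simp)
    filter_upwards [hmC] with x hx
    have := hFc x hx
    gcongr
  have := Real.log_le_log (integral_exp_pos (hint k)) hub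
  rw [Real.log_mul hm.ne' (Real.exp_ne_zero _), Real.log_exp] at this
  rw [div_lt_iff₀ hk] at hlog
  rw [inv_mul_lt_iff₀ hk]
  linarith

theorem eventually_lt_inv_mul_log_integral_exp (hmC : ∀ᵐ x ∂m, x ∈ C)
    (hF : TendstoUniformlyOn F h atTop C) (hh : ContinuousWithinAt h C y) (hy : y ∈ m.support)
    (hay : a < h y) (hint : ∀ k : ℕ, Integrable (fun x => Real.exp (k * F k x)) m) :
    ∀ᶠ k : ℕ in atTop, a < (k : ℝ)⁻¹ * Real.log (∫ x, Real.exp (k * F k x) ∂m) := by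
  obtain ⟨c, hac, hcy⟩ := exists_between hay
  obtain ⟨b, hcb, hby⟩ := exists_between hcy
  obtain ⟨U, hU, hUb⟩ := mem_nhdsWithin_iff_exists_mem_nhds_inter.1
    (hh.eventually_const_lt hby)
  have hmU : 0 < m.real U :=
    ENNReal.toReal_pos ((Measure.mem_support_iff_forall y).1 hy U hU).ne' (measure_ne_top _ _)
  filter_upwards [Metric.tendstoUniformlyOn_iff.1 hF (b - c) (sub_pos.2 hcb),
    (tendsto_const_div_atTop_nhds_zero_nat (Real.log (m.real U))).eventually_const_lt
      (sub_neg.2 hac), eventually_gt_atTop 0] with k hFk hlog hk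
  have hk : (0 : ℝ) < k := Nat.cast_pos.2 hk
  have hcF : ∀ x ∈ U ∩ C, c ≤ F k x := fun x hx => by
    have hbx : b < h x := hUb hx
    linarith [(abs_lt.1 (hFk x hx.2)).2]
  have hlb : Real.exp (k * c) * m.real U ≤ ∫ x, Real.exp (k * F k x) ∂m := by
    refine le_trans ?_ (mul_meas_ge_le_integral_of_nonneg
      (Eventually.of_forall fun x => (Real.exp_pos _).le) (hint k) (Real.exp (k * c)))
    refine mul_le_mul_of_nonneg_left (ENNReal.toReal_mono (measure_ne_top _ _)
      (measure_mono_ae ?_)) (Real.exp_pos _).le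
    filter_upwards [hmC] with x hxC hxU
    exact Real.exp_le_exp.2 (mul_le_mul_of_nonneg_left (hcF x ⟨hxU, hxC⟩) hk.le)
  have := Real.log_le_log (by positivity) hlb
  rw [Real.log_mul (Real.exp_ne_zero _) hmU.ne', Real.log_exp] at this
  rw [lt_div_iff₀ hk] at hlog
  rw [lt_inv_mul_iff₀ hk]
  linarith

theorem tendsto_inv_mul_log_integral_exp (hmC : ∀ᵐ x ∂m, x ∈ C)
    (hF : TendstoUniformlyOn F h atTop C) (hh : ContinuousWithinAt h C y) (hy : y ∈ m.support)
    (hmax : IsMaxOn h C y) (hint : ∀ k : ℕ, Integrable (fun x => Real.exp (k * F k x)) m) :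
    Tendsto (fun k : ℕ => (k : ℝ)⁻¹ * Real.log (∫ x, Real.exp (k * F k x) ∂m)) atTop
      (𝓝 (h y)) := by
  have : NeZero m := ⟨by rintro rfl; simp at hy⟩
  exact tendsto_order.2 ⟨fun a ha => eventually_lt_inv_mul_log_integral_exp hmC hF hh hy ha hint,
    fun a ha => eventually_inv_mul_log_integral_exp_lt hmC hF (fun x hx => hmax hx) ha hint⟩

end Laplace

section Argmax

theorem tendsto_of_isMaxOn {α ι : Type*} [TopologicalSpace α] {l : Filter ι} {s : Set α}
    (hs : IsCompact s) {F : ι → α → ℝ} {h : α → ℝ} (hh : ContinuousOn h s)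
    (hF : TendstoUniformlyOn F h l s) {y : α} (hy : y ∈ s) (hlt : ∀ z ∈ s, z ≠ y → h z < h y)
    {x : ι → α} (hx : ∀ᶠ i in l, x i ∈ s ∧ IsMaxOn (F i) s (x i)) : Tendsto x l (𝓝 y) := by
  refine tendsto_nhds.2 fun U hU hyU => ?_
  rcases (s \ U).eq_empty_or_nonempty with hempty | hne
  · filter_upwards [hx] with i hi
    exact Set.sdiff_eq_empty.1 hempty hi.1
  · obtain ⟨z, hz, hzmax⟩ := (hs.diff hU).exists_isMaxOn hne (hh.mono Set.sdiff_subset)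
    have hzy : h z < h y := hlt z hz.1 fun h => hz.2 (h ▸ hyU)
    filter_upwards [hx, Metric.tendstoUniformlyOn_iff.1 hF ((h y - h z) / 2) (by linarith)]
      with i hi hFi
    by_contra hiU
    have hxz : h (x i) ≤ h z := hzmax ⟨hi.1, hiU⟩
    have hyx : F i y ≤ F i (x i) := hi.2 hy
    linarith [(abs_lt.1 (hFi (x i) hi.1)).1, (abs_lt.1 (hFi y hy)).2]

end Argmax

section UniformLaw

open ProbabilityTheory

theorem measurable_continuousMap_of_eval {α K : Type*} [MeasurableSpace α] [TopologicalSpace K]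
    [CompactSpace K] [LocallyCompactSpace K] [SecondCountableTopology K]
    [MeasurableSpace C(K, ℝ)] [BorelSpace C(K, ℝ)] {φ : α → C(K, ℝ)}
    (hφ : ∀ x, Measurable fun a => φ a x) : Measurable φ := by
  obtain ⟨d, hdc, hd⟩ := TopologicalSpace.exists_countable_dense K
  have := hdc.to_subtype
  -- Lusin–Souslin: a continuous injection of a Polish space is a measurable embedding.
  have hemb : MeasurableEmbedding fun (f : C(K, ℝ)) (x : d) => f x :=
    Continuous.measurableEmbedding (by fun_prop) fun f g hfg =>
      ContinuousMap.ext (congrFun (Continuous.ext_on hd f.continuous g.continuous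
        fun x hx => congrFun hfg ⟨x, hx⟩))
  exact hemb.measurable_comp_iff.1 (measurable_pi_lambda _ fun x => hφ x)

variable {X : Type*} [MeasurableSpace X] {m : Measure X} [IsProbabilityMeasure m]

theorem strong_law_infinitePi {E : Type*} [NormedAddCommGroup E] [NormedSpace ℝ E]
    [CompleteSpace E] {Y : X → E} (hY : Integrable Y m) :
    ∀ᵐ ξ ∂(Measure.infinitePi fun _ : ℕ => m),
      Tendsto (fun k : ℕ => (k : ℝ)⁻¹ • ∑ j ∈ Finset.range k, Y (ξ j)) atTop
        (𝓝 (∫ x, Y x ∂m)) := by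
  borelize E
  have heval := measurePreserving_eval_infinitePi fun _ : ℕ => m
  have hYm : ∀ j, AEMeasurable Y ((Measure.infinitePi fun _ : ℕ => m).map (Function.eval j)) :=
    fun j => by rw [(heval j).map_eq]; exact hY.1.aemeasurable
  have hindep : iIndepFun (fun j ξ => Y (ξ j)) (Measure.infinitePi fun _ : ℕ => m) :=
    (iIndepFun_infinitePi (P := fun _ : ℕ => m) (X := fun _ => id) fun _ => measurable_id).comp₀
      (fun _ => Y) (fun j => (measurable_pi_apply j).aemeasurable) hYm
  have hident : ∀ j, IdentDistrib (fun ξ => Y (ξ j)) (fun ξ => Y (ξ 0))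
      (Measure.infinitePi fun _ : ℕ => m) (Measure.infinitePi fun _ : ℕ => m) := fun j =>
    IdentDistrib.comp_of_aemeasurable ⟨(measurable_pi_apply j).aemeasurable,
      (measurable_pi_apply 0).aemeasurable, (heval j).map_eq.trans (heval 0).map_eq.symm⟩ (hYm j)
  have hmean : ∫ ξ, Y (ξ 0) ∂(Measure.infinitePi fun _ : ℕ => m) = ∫ x, Y x ∂m := by
    have h := integral_map (heval 0).measurable.aemeasurable ((heval 0).map_eq.symm ▸ hY.1)
    rw [(heval 0).map_eq] at h
    exact h.symm
  have hlaw := strong_law_ae (fun j (ξ : ℕ → X) => Y (ξ j))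
    ((heval 0).integrable_comp_of_integrable hY) (fun i j hij => hindep.indepFun hij) hident
  rwa [hmean] at hlaw

variable {K : Type*} [TopologicalSpace K] [CompactSpace K] [LocallyCompactSpace K]
  [SecondCountableTopology K] {g : X → K → ℝ} {bound : X → ℝ}

omit [IsProbabilityMeasure m] in
theorem integrable_mkD (hgm : ∀ y, Measurable fun x => g x y)
    (hgc : ∀ᵐ x ∂m, Continuous (g x)) (hbound : Integrable bound m)
    (hgb : ∀ᵐ x ∂m, ∀ y, ‖g x y‖ ≤ bound x) :
    Integrable (fun x => ContinuousMap.mkD (g x) 0) m := by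
  borelize C(K, ℝ)
  refine ⟨?_, ContinuousMap.hasFiniteIntegral_mkD_of_bound g 0 hgc bound hbound.2 hgb⟩
  obtain ⟨t, htc, htm, ht⟩ := exists_measurable_superset_of_null hgc
  have hind : ∀ y, (fun x => ContinuousMap.mkD (tᶜ.indicator g x) 0 y) =
      tᶜ.indicator fun x => g x y := fun y => funext fun x => by
    by_cases hx : x ∈ t
    · rw [Set.indicator_of_notMem (by simpa), Set.indicator_of_notMem (by simpa)]
      exact ContinuousMap.mkD_apply_of_continuous (f := 0) continuous_const
    · have hgx : Continuous (g x) := not_not.1 fun h => hx (htc h)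
      rw [Set.indicator_of_mem (by simpa), Set.indicator_of_mem (by simpa),
        ContinuousMap.mkD_apply_of_continuous hgx]
  have hmeas : Measurable fun x => ContinuousMap.mkD (tᶜ.indicator g x) 0 :=
    measurable_continuousMap_of_eval fun y => hind y ▸ (hgm y).indicator htm.compl
  refine AEMeasurable.aestronglyMeasurable ⟨_, hmeas, ?_⟩
  filter_upwards [measure_eq_zero_iff_ae_notMem.1 ht] with x hx
  rw [Set.indicator_of_mem (Set.mem_compl hx)]

theorem ae_tendstoUniformly_average (hgm : ∀ y, Measurable fun x => g x y)
    (hgc : ∀ᵐ x ∂m, Continuous (g x)) (hbound : Integrable bound m)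
    (hgb : ∀ᵐ x ∂m, ∀ y, ‖g x y‖ ≤ bound x) :
    ∀ᵐ ξ ∂(Measure.infinitePi fun _ : ℕ => m),
      TendstoUniformly (fun (k : ℕ) y => (k : ℝ)⁻¹ * ∑ j ∈ Finset.range k, g (ξ j) y)
        (fun y => ∫ x, g x y ∂m) atTop := by
  have hi := integrable_mkD hgm hgc hbound hgb
  have hcoord : ∀ᵐ ξ ∂(Measure.infinitePi fun _ : ℕ => m), ∀ j, Continuous (g (ξ j)) :=
    ae_all_iff.2 fun j =>
      (measurePreserving_eval_infinitePi (fun _ : ℕ => m) j).quasiMeasurePreserving.ae hgc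
  have hmean : ∀ y, (∫ x, ContinuousMap.mkD (g x) 0 ∂m) y = ∫ x, g x y ∂m := fun y =>
    (ContinuousMap.integral_apply hi y).trans <| integral_congr_ae <|
      hgc.mono fun x hx => ContinuousMap.mkD_apply_of_continuous hx
  filter_upwards [strong_law_infinitePi hi, hcoord] with ξ hlim hξ
  convert ContinuousMap.tendsto_iff_tendstoUniformly.1 hlim using 1
  · funext k y
    simp only [ContinuousMap.smul_apply, ContinuousMap.sum_apply, smul_eq_mul,
      ContinuousMap.mkD_apply_of_continuous (hξ _)]
  · exact funext fun y => (hmean y).symm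

end UniformLaw

section Gibbs

theorem integral_log_lt_integral_log {X : Type*} [MeasurableSpace X] {μ : Measure X} {f g : X → ℝ}
    (hf : Measurable f) (hg : Measurable g) (hf0 : 0 ≤ f) (hg0 : 0 ≤ g)
    [IsProbabilityMeasure (μ.withDensity fun x => ENNReal.ofReal (f x))]
    [IsProbabilityMeasure (μ.withDensity fun x => ENNReal.ofReal (g x))]
    (hpos : ∀ᵐ x ∂(μ.withDensity fun x => ENNReal.ofReal (f x)), 0 < g x)
    (hfi : Integrable (fun x => Real.log (f x)) (μ.withDensity fun x => ENNReal.ofReal (f x)))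
    (hgi : Integrable (fun x => Real.log (g x)) (μ.withDensity fun x => ENNReal.ofReal (f x)))
    (hne : ¬ f =ᵐ[μ] g) :
    ∫ x, Real.log (g x) ∂(μ.withDensity fun x => ENNReal.ofReal (f x)) <
      ∫ x, Real.log (f x) ∂(μ.withDensity fun x => ENNReal.ofReal (f x)) := by
  set P := μ.withDensity fun x => ENNReal.ofReal (f x) with hP
  set Q := μ.withDensity fun x => ENNReal.ofReal (g x) with hQ
  have hfg : Measurable fun x => ENNReal.ofReal (f x / g x) := (hf.div hg).ennreal_ofReal
  have hPQ : P = Q.withDensity fun x => ENNReal.ofReal (f x / g x) := by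
    rw [hQ, ← withDensity_mul μ hg.ennreal_ofReal hfg]
    refine withDensity_congr_ae ?_
    rw [hP, ae_withDensity_iff hf.ennreal_ofReal] at hpos
    filter_upwards [hpos] with x hx
    rw [Pi.mul_apply, ← ENNReal.ofReal_mul (hg0 x)]
    rcases (hf0 x).eq_or_lt with h | h
    · simp [← h]
    · rw [mul_div_cancel₀ _ (hx (by simpa using h)).ne']
  have hac : P ≪ Q := hPQ ▸ withDensity_absolutelyContinuous Q _
  have hfpos : ∀ᵐ x ∂P, 0 < f x :=
    (ae_withDensity_iff hf.ennreal_ofReal).2 (Eventually.of_forall fun x hx => by simpa using hx)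
  have hllr : llr P Q =ᵐ[P] fun x => Real.log (f x) - Real.log (g x) := by
    filter_upwards [hac.ae_eq (hPQ ▸ Measure.rnDeriv_withDensity Q hfg), hpos, hfpos]
      with x hx hgx hfx
    rw [llr, hx, ENNReal.toReal_ofReal (by positivity), Real.log_div hfx.ne' hgx.ne']
  have hkl : (InformationTheory.klDiv P Q).toReal =
      ∫ x, Real.log (f x) ∂P - ∫ x, Real.log (g x) ∂P := by
    rw [InformationTheory.toReal_klDiv_of_measure_eq hac (by simp), integral_congr_ae hllr,
      integral_sub hfi hgi]
  have hkl0 : InformationTheory.klDiv P Q ≠ 0 := fun h => hne <| by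
    have hfin : ∫⁻ x, ENNReal.ofReal (f x) ∂μ ≠ ∞ := by
      rw [← setLIntegral_univ, ← withDensity_apply _ MeasurableSet.univ]
      exact measure_ne_top P _
    have := (withDensity_eq_iff hf.ennreal_ofReal.aemeasurable hg.ennreal_ofReal.aemeasurable
      hfin).1 (InformationTheory.klDiv_eq_zero_iff.1 h)
    filter_upwards [this] with x hx
    exact (ENNReal.ofReal_eq_ofReal_iff (hf0 x) (hg0 x)).1 hx
  have := ENNReal.toReal_pos hkl0
    (InformationTheory.klDiv_ne_top hac ((hfi.sub hgi).congr hllr.symm))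
  linarith

end Gibbs

section LogEnvelope

theorem continuous_ereal_abs : Continuous EReal.abs := by
  have habs : EReal.abs = fun x => max x.toENNReal (-x).toENNReal := by
    funext x
    induction x with
    | bot => simp
    | top => simp
    | coe x =>
      rw [EReal.abs_def, ← EReal.coe_neg, EReal.toENNReal_of_ne_top (EReal.coe_ne_top _),
        EReal.toENNReal_of_ne_top (EReal.coe_ne_top _), EReal.toReal_coe, EReal.toReal_coe]
      exact ENNReal.ofReal_mono.map_max
  rw [habs]
  fun_prop

theorem measurable_biSup_of_continuousOn {α β : Type*} [MeasurableSpace α] [TopologicalSpace β]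
    {s : Set β} [TopologicalSpace.SeparableSpace s] {f : α → β → ℝ≥0∞}
    (hf : ∀ y ∈ s, Measurable fun x => f x y) (hc : ∀ x, ContinuousOn (f x) s) :
    Measurable fun x => ⨆ y ∈ s, f x y := by
  obtain ⟨d, hdc, hd⟩ := TopologicalSpace.exists_countable_dense s
  have := hdc.to_subtype
  have hsup : ∀ x, ⨆ y ∈ s, f x y = ⨆ y : d, f x y := fun x => by
    rw [iSup_subtype']
    exact (hd.ciSup' (hc x).domRestrict).symm
  simp only [hsup]
  exact Measurable.iSup fun y => hf _ y.1.2

variable {X : Type*} {V : X → ℝ → ℂ} {σ : Set ℝ} {ξ : X} {ν ν' : ℝ}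

theorem toReal_logLikelihood (V : X → ℝ → ℂ) (ν : ℝ) (ξ : X) :
    (logLikelihood V ν ξ).toReal = Real.log (likelihood V ξ ν) := by
  rw [logLikelihood, ENNReal.log_ofReal]
  split_ifs with h
  · simp [le_antisymm h (likelihood_nonneg V ξ ν)]
  · rw [EReal.toReal_coe]

theorem logLikelihood_of_pos (h : 0 < likelihood V ξ ν) :
    logLikelihood V ν ξ = (Real.log (likelihood V ξ ν) : ℝ) :=
  ENNReal.log_ofReal_of_pos h

/-- The dominating function `sup_{ν ∈ σ} |l(ν|ξ)|` of the dominance assumption. -/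
noncomputable def logEnvelope (V : X → ℝ → ℂ) (σ : Set ℝ) (ξ : X) : ℝ≥0∞ :=
  ⨆ ν ∈ σ, (logLikelihood V ν ξ).abs

theorem likelihood_pos_of_logEnvelope_lt_top (h : logEnvelope V σ ξ < ∞) (hν : ν ∈ σ) :
    0 < likelihood V ξ ν := by
  refine (likelihood_nonneg V ξ ν).lt_of_ne fun h0 => ?_
  have htop : (logLikelihood V ν ξ).abs = ∞ := by
    rw [logLikelihood, ← h0, ENNReal.ofReal_zero, ENNReal.log_zero, EReal.abs_bot]
  exact ((le_biSup (fun ν => (logLikelihood V ν ξ).abs) hν).trans_lt h).ne htop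

theorem norm_log_likelihood_le (h : logEnvelope V σ ξ < ∞) (hν : ν ∈ σ) :
    ‖Real.log (likelihood V ξ ν)‖ ≤ (logEnvelope V σ ξ).toReal := by
  rw [Real.norm_eq_abs, ← ENNReal.ofReal_le_iff_le_toReal h.ne, ← EReal.abs_def,
    ← logLikelihood_of_pos (likelihood_pos_of_logEnvelope_lt_top h hν)]
  exact le_biSup (fun ν => (logLikelihood V ν ξ).abs) hν

theorem avgLogLikelihood_of_pos {k : ℕ} {ξ : ℕ → X} (h : ∀ j, 0 < likelihood V (ξ j) ν) :
    avgLogLikelihood V k ξ ν =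
      (((k : ℝ)⁻¹ * ∑ j ∈ Finset.range k, Real.log (likelihood V (ξ j) ν) : ℝ) : EReal) := by
  have hsum : ∑ j ∈ Finset.range k, logLikelihood V ν (ξ j) =
      ((∑ j ∈ Finset.range k, Real.log (likelihood V (ξ j) ν) : ℝ) : EReal) := by
    induction k with
    | zero => simp
    | succ k ih =>
      rw [Finset.sum_range_succ, Finset.sum_range_succ, EReal.coe_add, ih,
        logLikelihood_of_pos (h k)]
  rw [avgLogLikelihood, hsum, one_div, EReal.coe_mul]

theorem prod_likelihood_eq_exp {ξ : ℕ → X} (h : ∀ j, 0 < likelihood V (ξ j) ν) (k : ℕ) :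
    ∏ j ∈ Finset.range k, likelihood V (ξ j) ν =
      Real.exp (k * ((k : ℝ)⁻¹ * ∑ j ∈ Finset.range k, Real.log (likelihood V (ξ j) ν))) := by
  rcases k.eq_zero_or_pos with rfl | hk
  · simp
  · rw [mul_inv_cancel_left₀ (Nat.cast_ne_zero.2 hk.ne'), Real.exp_sum]
    exact Finset.prod_congr rfl fun j _ => (Real.exp_log (h j)).symm

end LogEnvelope

section ExpectedLog

variable {X : Type*} [MeasurableSpace X] {μ : Measure X} {V : X → ℝ → ℂ} {σ : Set ℝ} {ν ν' : ℝ}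

theorem measurable_logEnvelope (hV : IsJumpFamily μ V)
    (hc : ∀ ξ, ContinuousOn (fun ν => likelihood V ξ ν) σ) : Measurable (logEnvelope V σ) :=
  measurable_biSup_of_continuousOn
    (fun ν _ => continuous_ereal_abs.measurable.comp
      (ENNReal.measurable_log.comp (hV.measurable_likelihood_left ν).ennreal_ofReal))
    fun ξ => (continuous_ereal_abs.comp
      (ENNReal.continuous_log.comp ENNReal.continuous_ofReal)).comp_continuousOn (hc ξ)

theorem ae_logEnvelope_lt_top (hV : IsJumpFamily μ V) (hf : LikelihoodAssumption μ V σ)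
    (hν : ν ∈ σ) : ∀ᵐ ξ ∂(outcomeMeasure μ V ν), logEnvelope V σ ξ < ∞ :=
  ae_lt_top (measurable_logEnvelope hV hf.continuousOn) (hf.dominated ν hν).ne

theorem integrable_logEnvelope (hV : IsJumpFamily μ V) (hf : LikelihoodAssumption μ V σ)
    (hν : ν ∈ σ) : Integrable (fun ξ => (logEnvelope V σ ξ).toReal) (outcomeMeasure μ V ν) :=
  integrable_toReal_of_lintegral_ne_top (measurable_logEnvelope hV hf.continuousOn).aemeasurable
    (hf.dominated ν hν).ne

theorem integrable_log_likelihood (hV : IsJumpFamily μ V) (hf : LikelihoodAssumption μ V σ)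
    (hν : ν ∈ σ) (hν' : ν' ∈ σ) :
    Integrable (fun ξ => Real.log (likelihood V ξ ν')) (outcomeMeasure μ V ν) :=
  (integrable_logEnvelope hV hf hν).mono'
    (hV.measurable_likelihood_left ν').log.aestronglyMeasurable
    ((ae_logEnvelope_lt_top hV hf hν).mono fun _ hξ => norm_log_likelihood_le hξ hν')

theorem ae_continuous_log_likelihood (hV : IsJumpFamily μ V) (hf : LikelihoodAssumption μ V σ)
    (hν : ν ∈ σ) : ∀ᵐ ξ ∂(outcomeMeasure μ V ν),
      Continuous fun ν' : σ => Real.log (likelihood V ξ ν') := by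
  filter_upwards [ae_logEnvelope_lt_top hV hf hν] with ξ hξ
  exact (hf.continuousOn ξ).domRestrict.log fun ν' =>
    (likelihood_pos_of_logEnvelope_lt_top hξ ν'.2).ne'

/-- The expected log-likelihood `𝔼_ν[l(ν'|ξ)]` of `ν'` when the outcomes are governed by `ν`. -/
noncomputable def expectedLog (μ : Measure X) (V : X → ℝ → ℂ) (ν ν' : ℝ) : ℝ :=
  ∫ ξ, Real.log (likelihood V ξ ν') ∂(outcomeMeasure μ V ν)

theorem continuousOn_expectedLog (hV : IsJumpFamily μ V) (hf : LikelihoodAssumption μ V σ)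
    (hν : ν ∈ σ) : ContinuousOn (expectedLog μ V ν) σ :=
  continuousOn_iff_continuous_domRestrict.2 <|
    continuous_of_dominated
      (fun ν' => (hV.measurable_likelihood_left ν').log.aestronglyMeasurable)
      (fun ν' => (ae_logEnvelope_lt_top hV hf hν).mono fun _ hξ => norm_log_likelihood_le hξ ν'.2)
      (integrable_logEnvelope hV hf hν) (ae_continuous_log_likelihood hV hf hν)

theorem ae_tendstoUniformlyOn_average_log_likelihood [SigmaFinite μ] (hV : IsJumpFamily μ V)
    (hf : LikelihoodAssumption μ V σ) (hσ : IsCompact σ) (hν : ν ∈ σ) :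
    ∀ᵐ ξ ∂(hV.sequenceKernel ν), (∀ j, ∀ ν' ∈ σ, 0 < likelihood V (ξ j) ν') ∧
      TendstoUniformlyOn (fun (k : ℕ) ν' => (k : ℝ)⁻¹ * ∑ j ∈ Finset.range k,
        Real.log (likelihood V (ξ j) ν')) (expectedLog μ V ν) atTop σ := by
  have := hV.isProbabilityMeasure_outcomeMeasure ν
  have := isCompact_iff_compactSpace.1 hσ
  rw [hV.sequenceKernel_apply]
  have hfin : ∀ᵐ ξ ∂(Measure.infinitePi fun _ : ℕ => outcomeMeasure μ V ν),
      ∀ j, logEnvelope V σ (ξ j) < ∞ :=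
    ae_all_iff.2 fun j => (measurePreserving_eval_infinitePi
      (fun _ : ℕ => outcomeMeasure μ V ν) j).quasiMeasurePreserving.ae
        (ae_logEnvelope_lt_top hV hf hν)
  have hunif := ae_tendstoUniformly_average (m := outcomeMeasure μ V ν)
    (g := fun ξ (ν' : σ) => Real.log (likelihood V ξ ν'))
    (fun ν' => (hV.measurable_likelihood_left ν').log) (ae_continuous_log_likelihood hV hf hν)
    (integrable_logEnvelope hV hf hν)
    ((ae_logEnvelope_lt_top hV hf hν).mono fun _ hξ ν' => norm_log_likelihood_le hξ ν'.2)
  filter_upwards [hfin, hunif] with ξ hξ hlim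
  exact ⟨fun j ν' hν' => likelihood_pos_of_logEnvelope_lt_top (hξ j) hν',
    tendstoUniformlyOn_iff_tendstoUniformly_comp_coe.2 hlim⟩

theorem expectedLog_lt (hV : IsJumpFamily μ V) (hf : LikelihoodAssumption μ V σ)
    (hν : ν ∈ σ) (hν' : ν' ∈ σ) (hne : ν' ≠ ν) : expectedLog μ V ν ν' < expectedLog μ V ν ν := by
  have : IsProbabilityMeasure (μ.withDensity fun ξ => ENNReal.ofReal (likelihood V ξ ν)) :=
    hV.isProbabilityMeasure_outcomeMeasure ν
  have : IsProbabilityMeasure (μ.withDensity fun ξ => ENNReal.ofReal (likelihood V ξ ν')) :=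
    hV.isProbabilityMeasure_outcomeMeasure ν'
  exact integral_log_lt_integral_log (hV.measurable_likelihood_left ν)
    (hV.measurable_likelihood_left ν') (fun ξ => likelihood_nonneg V ξ ν)
    (fun ξ => likelihood_nonneg V ξ ν')
    ((ae_logEnvelope_lt_top hV hf hν).mono fun _ hξ => likelihood_pos_of_logEnvelope_lt_top hξ hν')
    (integrable_log_likelihood hV hf hν hν) (integrable_log_likelihood hV hf hν hν')
    (hf.identifiable ν hν ν' hν' hne.symm)

theorem isMaxOn_expectedLog (hV : IsJumpFamily μ V) (hf : LikelihoodAssumption μ V σ)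
    (hν : ν ∈ σ) : IsMaxOn (expectedLog μ V ν) σ ν := isMaxOn_iff.2 fun ν' hν' => by
  rcases eq_or_ne ν' ν with rfl | hne
  · exact le_rfl
  · exact (expectedLog_lt hV hf hν hν' hne).le

theorem ae_tendsto_maximumLikelihoodEstimator [SigmaFinite μ] (hV : IsJumpFamily μ V)
    (hf : LikelihoodAssumption μ V σ) (hσ : IsCompact σ) {Nhat : ℕ → (ℕ → X) → ℝ}
    (hNhat : IsMaximumLikelihoodEstimator V σ Nhat) (hν : ν ∈ σ) :
    ∀ᵐ ξ ∂(hV.sequenceKernel ν), Tendsto (fun k => Nhat k ξ) atTop (𝓝 ν) := by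
  filter_upwards [ae_tendstoUniformlyOn_average_log_likelihood hV hf hσ hν] with ξ ⟨hpos, hunif⟩
  refine tendsto_of_isMaxOn hσ (continuousOn_expectedLog hV hf hν) hunif hν
    (fun ν' hν' hne => expectedLog_lt hV hf hν hν' hne) ?_
  filter_upwards [eventually_ge_atTop 1] with k hk
  obtain ⟨hmem, hmax⟩ := (hNhat k hk).2 ξ
  refine ⟨hmem, fun ν' hν' => EReal.coe_le_coe_iff.1 ?_⟩
  rw [← avgLogLikelihood_of_pos fun j => hpos j ν' hν',
    ← avgLogLikelihood_of_pos fun j => hpos j _ hmem]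
  exact hmax hν'

theorem exists_relativeEntropy_eq (hV : IsJumpFamily μ V) (hf : LikelihoodAssumption μ V σ)
    (hν : ν ∈ σ) {C : Set ℝ} (hC : IsCompact C) (hCne : C.Nonempty) (hCσ : C ⊆ σ) :
    ∃ y ∈ C, IsMaxOn (expectedLog μ V ν) C y ∧
      relativeEntropy μ V ν C = expectedLog μ V ν ν - expectedLog μ V ν y := by
  obtain ⟨y, hy, hmax⟩ := hC.exists_isMaxOn hCne ((continuousOn_expectedLog hV hf hν).mono hCσ)
  refine ⟨y, hy, hmax, ?_⟩
  have hgap : ∀ ν' ∈ C, ∫ ξ, ((logLikelihood V ν ξ).toReal - (logLikelihood V ν' ξ).toReal)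
      ∂(outcomeMeasure μ V ν) = expectedLog μ V ν ν - expectedLog μ V ν ν' := fun ν' hν' => by
    simp only [toReal_logLikelihood]
    exact integral_sub (integrable_log_likelihood hV hf hν hν)
      (integrable_log_likelihood hV hf hν (hCσ hν'))
  rw [relativeEntropy, Set.image_congr hgap]
  refine IsLeast.csInf_eq ⟨⟨y, hy, rfl⟩, ?_⟩
  rintro _ ⟨z, hz, rfl⟩
  exact sub_le_sub_left (hmax hz) _

end ExpectedLog

section Mixture

open ProbabilityTheory

variable {Θ Ω : Type*} [MeasurableSpace Θ] [MeasurableSpace Ω] {κ : Kernel Θ Ω} {m : Measure Θ}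

theorem exists_measurable_limit_comp {E : Type*} [TopologicalSpace E] [PolishSpace E]
    [MeasurableSpace E] [BorelSpace E] {Y : ℕ → Ω → E} {s : Θ → E}
    (hY : ∀ k, Measurable (Y k))
    (hs : ∀ᵐ θ ∂m, ∀ᵐ ω ∂(κ θ), Tendsto (fun k => Y k ω) atTop (𝓝 (s θ))) :
    ∃ Z : Ω → E, Measurable Z ∧
      (∀ᵐ ω ∂(κ ∘ₘ m), Tendsto (fun k => Y k ω) atTop (𝓝 (Z ω))) ∧
      ∀ᵐ θ ∂m, ∀ᵐ ω ∂(κ θ), Z ω = s θ := by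
  have hconv : ∀ᵐ ω ∂(κ ∘ₘ m), ∃ l, Tendsto (fun k => Y k ω) atTop (𝓝 l) :=
    Measure.ae_comp_of_ae_ae (measurableSet_exists_tendsto hY)
      (hs.mono fun θ hθ => hθ.mono fun _ hω => ⟨s θ, hω⟩)
  obtain ⟨Z, hZm, hZ⟩ := measurable_limit_of_tendsto_metrizable_ae
    (fun k => (hY k).aemeasurable) hconv
  refine ⟨Z, hZm, hZ, ?_⟩
  filter_upwards [hs, Measure.ae_ae_of_ae_comp hZ] with θ hsθ hZθ
  filter_upwards [hsθ, hZθ] with ω h₁ h₂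
  exact tendsto_nhds_unique h₂ h₁

theorem map_comp_eq_of_ae_eq [IsMarkovKernel κ] {T : Ω → Θ} (hT : Measurable T)
    (hTκ : ∀ᵐ θ ∂m, ∀ᵐ ω ∂(κ θ), T ω = θ) : (κ ∘ₘ m).map T = m := by
  ext B hB
  rw [Measure.map_apply hT hB, Measure.bind_apply (hT hB) κ.aemeasurable,
    ← lintegral_indicator_one hB]
  refine lintegral_congr_ae (hTκ.mono fun θ hθ => ?_)
  have hdirac : (κ θ).map T = Measure.dirac θ := by
    rw [Measure.map_congr hθ, Measure.map_const, measure_univ, one_smul]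
  simp only [← Measure.map_apply hT hB, hdirac, Measure.dirac_apply' θ hB]

/-- The limit function `s` need not be measurable: it agrees `m`-almost everywhere with the
conditional mean of the limit of `Y`. -/
theorem ae_tendsto_comp [IsMarkovKernel κ] {T : Ω → Θ} (hT : Measurable T)
    (hTκ : ∀ᵐ θ ∂m, ∀ᵐ ω ∂(κ θ), T ω = θ) {Y : ℕ → Ω → ℝ} {s : Θ → ℝ}
    (hY : ∀ k, Measurable (Y k))
    (hs : ∀ᵐ θ ∂m, ∀ᵐ ω ∂(κ θ), Tendsto (fun k => Y k ω) atTop (𝓝 (s θ))) :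
    ∀ᵐ ω ∂(κ ∘ₘ m), Tendsto (fun k => Y k ω) atTop (𝓝 (s (T ω))) := by
  obtain ⟨Z, hZm, hYZ, hZs⟩ := exists_measurable_limit_comp hY hs
  have hmean : Measurable fun θ => ∫ ω, Z ω ∂(κ θ) :=
    hZm.stronglyMeasurable.integral_kernel.measurable
  have hsmean : ∀ᵐ θ ∂m, s θ = ∫ ω, Z ω ∂(κ θ) := hZs.mono fun θ hθ => by
    rw [integral_congr_ae hθ, integral_const, probReal_univ, one_smul]
  have hZmean : ∀ᵐ ω ∂(κ ∘ₘ m), Z ω = ∫ ω', Z ω' ∂(κ (T ω)) := by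
    refine Measure.ae_comp_of_ae_ae (measurableSet_eq_fun hZm (hmean.comp hT)) ?_
    filter_upwards [hTκ, hZs, hsmean] with θ hTθ hZθ hsθ
    filter_upwards [hTθ, hZθ] with ω hTω hZω
    rw [hTω, hZω, hsθ]
  have hsT : ∀ᵐ ω ∂(κ ∘ₘ m), s (T ω) = ∫ ω', Z ω' ∂(κ (T ω)) :=
    ae_of_ae_map hT.aemeasurable (by rwa [map_comp_eq_of_ae_eq hT hTκ])
  filter_upwards [hYZ, hZmean, hsT] with ω hω hZω hsω
  rwa [hsω, ← hZω]

end Mixture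

section PosteriorRate

open ProbabilityTheory

theorem closure_subset_support_restrict {α : Type*} [TopologicalSpace α]
    [MeasurableSpace α] [OpensMeasurableSpace α] {m : Measure α}
    {σ U : Set α} (hmσ : ∀ᵐ x ∂m, x ∈ σ) (hU : IsOpen U) (hUm : U ∩ σ ⊆ m.support) :
    closure (U ∩ σ) ⊆ (m.restrict (closure (U ∩ σ))).support := by
  have hUσ : m.restrict U = m.restrict (U ∩ σ) :=
    Measure.restrict_congr_set (inter_ae_eq_left_of_ae_eq_univ (eventuallyEq_univ.2 hmσ)).symm
  refine closure_minimal (fun x hx => ?_) Measure.isClosed_support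
  have hxU : x ∈ (m.restrict U).support :=
    Measure.interior_inter_support ⟨hU.interior_eq.symm ▸ hx.1, hUm hx⟩
  rw [hUσ] at hxU
  exact Measure.support_mono (Measure.restrict_mono subset_closure le_rfl) hxU

variable {X : Type*} [MeasurableSpace X] {μ : Measure X} {V : X → ℝ → ℂ} {σ C : Set ℝ} {ν y : ℝ}
  {m : Measure ℝ} [IsFiniteMeasure m] {ξ : ℕ → X}

theorem integral_prod_likelihood_pos [NeZero m] (hV : IsJumpFamily μ V)
    (hpos : ∀ᵐ ν ∂m, ∀ j, 0 < likelihood V (ξ j) ν) (k : ℕ) :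
    0 < ∫ ν, ∏ j ∈ Finset.range k, likelihood V (ξ j) ν ∂m := by
  have hexp := hpos.mono fun ν hν => prod_likelihood_eq_exp hν k
  rw [integral_congr_ae hexp]
  exact integral_exp_pos ((hV.integrable_prod_likelihood _ ξ m).congr hexp)

theorem tendsto_inv_mul_log_integral_prod_likelihood (hV : IsJumpFamily μ V)
    (hf : LikelihoodAssumption μ V σ) (hν : ν ∈ σ) (hCσ : C ⊆ σ) (hmC : ∀ᵐ ν' ∂m, ν' ∈ C)
    (hy : y ∈ C) (hym : y ∈ m.support) (hmax : IsMaxOn (expectedLog μ V ν) C y)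
    (hpos : ∀ j, ∀ ν' ∈ σ, 0 < likelihood V (ξ j) ν')
    (hunif : TendstoUniformlyOn (fun (k : ℕ) ν' => (k : ℝ)⁻¹ * ∑ j ∈ Finset.range k,
      Real.log (likelihood V (ξ j) ν')) (expectedLog μ V ν) atTop σ) :
    Tendsto (fun k : ℕ => (k : ℝ)⁻¹ * Real.log
      (∫ ν', ∏ j ∈ Finset.range k, likelihood V (ξ j) ν' ∂m)) atTop
      (𝓝 (expectedLog μ V ν y)) := by
  have hexp : ∀ k, (fun ν' => ∏ j ∈ Finset.range k, likelihood V (ξ j) ν') =ᵐ[m] fun ν' =>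
      Real.exp (k * ((k : ℝ)⁻¹ * ∑ j ∈ Finset.range k, Real.log (likelihood V (ξ j) ν'))) :=
    fun k => hmC.mono fun ν' hν' => prod_likelihood_eq_exp (fun j => hpos j ν' (hCσ hν')) k
  simp only [integral_congr_ae (hexp _)]
  exact tendsto_inv_mul_log_integral_exp hmC (hunif.mono hCσ)
    ((continuousOn_expectedLog hV hf hν).mono hCσ y hy) hym hmax
    fun k => (hV.integrable_prod_likelihood _ ξ m).congr (hexp k)

theorem measurable_posteriorProb (hV : IsJumpFamily μ V) (k : ℕ) :
    Measurable (posteriorProb m V C k) := by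
  have hprod : StronglyMeasurable fun p : (ℕ → X) × ℝ =>
      ∏ j ∈ Finset.range k, likelihood V (p.1 j) p.2 :=
    (Finset.measurable_fun_prod _ fun j _ =>
      hV.measurable_likelihood.comp (f := fun p : (ℕ → X) × ℝ => (p.1 j, p.2))
        (by fun_prop)).stronglyMeasurable
  exact hprod.integral_prod_right.measurable.div hprod.integral_prod_right.measurable

theorem tendsto_log_posteriorProb (hV : IsJumpFamily μ V) (hf : LikelihoodAssumption μ V σ)
    (hν : ν ∈ σ) (hmσ : ∀ᵐ ν' ∂m, ν' ∈ σ) (hνm : ν ∈ m.support) (hC : IsCompact C)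
    (hCne : C.Nonempty) (hCσ : C ⊆ σ) (hCm : C ⊆ (m.restrict C).support)
    (hpos : ∀ j, ∀ ν' ∈ σ, 0 < likelihood V (ξ j) ν')
    (hunif : TendstoUniformlyOn (fun (k : ℕ) ν' => (k : ℝ)⁻¹ * ∑ j ∈ Finset.range k,
      Real.log (likelihood V (ξ j) ν')) (expectedLog μ V ν) atTop σ) :
    (∀ k, 0 < posteriorProb m V C k ξ) ∧
      Tendsto (fun k : ℕ => -((1 / k : ℝ) * Real.log (posteriorProb m V C k ξ))) atTop
        (𝓝 (relativeEntropy μ V ν C)) := by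
  obtain ⟨y, hy, hmax, hentropy⟩ := exists_relativeEntropy_eq hV hf hν hC hCne hCσ
  have hmC : ∀ᵐ ν' ∂(m.restrict C), ν' ∈ C := ae_restrict_mem hC.measurableSet
  have : NeZero m := ⟨by rintro rfl; simp at hνm⟩
  have : NeZero (m.restrict C) := ⟨fun h => by simpa [h] using hCm hy⟩
  have hposσ := integral_prod_likelihood_pos hV (hmσ.mono fun ν' hν' j => hpos j ν' hν')
  have hposC := integral_prod_likelihood_pos hV (hmC.mono fun ν' hν' j => hpos j ν' (hCσ hν'))
  have hrateσ := tendsto_inv_mul_log_integral_prod_likelihood hV hf hν subset_rfl hmσ hν hνm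
    (isMaxOn_expectedLog hV hf hν) hpos hunif
  have hrateC := tendsto_inv_mul_log_integral_prod_likelihood hV hf hν hCσ hmC hy (hCm hy)
    hmax hpos hunif
  refine ⟨fun k => div_pos (hposC k) (hposσ k), ?_⟩
  rw [hentropy]
  refine (hrateσ.sub hrateC).congr fun k => ?_
  rw [posteriorProb, Real.log_div (hposC k).ne' (hposσ k).ne']
  ring

theorem ae_tendsto_log_posteriorProb [SigmaFinite μ] (hV : IsJumpFamily μ V)
    (hf : LikelihoodAssumption μ V σ) (hσ : IsCompact σ) (hmσ : ∀ᵐ ν ∂m, ν ∈ σ)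
    {T : (ℕ → X) → ℝ} (hT : Measurable T)
    (hTν : ∀ᵐ ν ∂m, ∀ᵐ ξ ∂(hV.sequenceKernel ν), T ξ = ν) (hC : IsClosed C) (hCne : C.Nonempty)
    (hCm : C ⊆ (m.restrict C).support) :
    ∀ᵐ ξ ∂(hV.sequenceKernel ∘ₘ m), (∀ k, 0 < posteriorProb m V C k ξ) ∧
      Tendsto (fun k : ℕ => -((1 / k : ℝ) * Real.log (posteriorProb m V C k ξ))) atTop
        (𝓝 (relativeEntropy μ V (T ξ) C)) := by
  have := hV.isMarkovKernel_sequenceKernel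
  have hCσ : C ⊆ σ := (hCm.trans Measure.support_restrict_subset).trans fun x hx =>
    Measure.support_subset_of_isClosed hσ.isClosed hmσ hx.2
  have hrate : ∀ᵐ ν ∂m, ∀ᵐ ξ ∂(hV.sequenceKernel ν), (∀ k, 0 < posteriorProb m V C k ξ) ∧
      Tendsto (fun k : ℕ => -((1 / k : ℝ) * Real.log (posteriorProb m V C k ξ))) atTop
        (𝓝 (relativeEntropy μ V ν C)) := by
    filter_upwards [hmσ, Measure.support_mem_ae] with ν hν hνm
    filter_upwards [ae_tendstoUniformlyOn_average_log_likelihood hV hf hσ hν] with ξ ⟨hpos, hunif⟩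
    exact tendsto_log_posteriorProb hV hf hν hmσ hνm (hσ.of_isClosed_subset hC hCσ) hCne hCσ hCm
      hpos hunif
  have hmeas : ∀ k, Measurable (posteriorProb m V C k) := fun k => measurable_posteriorProb hV k
  have hpos : ∀ᵐ ξ ∂(hV.sequenceKernel ∘ₘ m), ∀ k, 0 < posteriorProb m V C k ξ := by
    refine ae_all_iff.2 fun k => Measure.ae_comp_of_ae_ae
      (measurableSet_lt measurable_const (hmeas k)) ?_
    filter_upwards [hrate] with ν hν
    filter_upwards [hν] with ξ hξ using hξ.1 k
  have hlim := ae_tendsto_comp (s := fun ν => relativeEntropy μ V ν C)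
    (Y := fun k ξ => -((1 / k : ℝ) * Real.log (posteriorProb m V C k ξ))) hT hTν
    (fun k => ((hmeas k).log.const_mul _).neg)
    (hrate.mono fun _ h => h.mono fun _ h => h.2)
  exact hpos.and hlim

end PosteriorRate

end NonDemolition

theorem theorem2p2_general {H : Type*} [NormedAddCommGroup H] [InnerProductSpace ℂ H]
    [CompleteSpace H] {X : Type*} [MeasurableSpace X] (μ : Measure X) [SigmaFinite μ]
    (N : H →L[ℂ] H) (hN : IsSelfAdjoint N)
    (V : X → ℝ → ℂ) (hV : NonDemolition.IsJumpFamily μ V)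
    (ρ : H →L[ℂ] H) (hρ : NonDemolition.IsDensityMatrix ρ)
    (hf : NonDemolition.LikelihoodAssumption μ V (spectrum ℝ N))
    (Nhat : ℕ → (ℕ → X) → ℝ)
    (hNhat : NonDemolition.IsMaximumLikelihoodEstimator V (spectrum ℝ N) Nhat) :
    NonDemolition.IsOutcomeLaw N hN μ V ρ (NonDemolition.outcomeLaw N hN μ V ρ) ∧
    ∃ Ninf : (ℕ → X) → ℝ, Measurable Ninf ∧
      (∀ᵐ ξ ∂(NonDemolition.outcomeLaw N hN μ V ρ),
        Tendsto (fun k => Nhat k ξ) atTop (𝓝 (Ninf ξ))) ∧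
      (∀ B : Set ℝ, MeasurableSet B →
        (((NonDemolition.outcomeLaw N hN μ V ρ).real {ξ | Ninf ξ ∈ B} : ℝ) : ℂ) =
          NonDemolition.trace (NonDemolition.spectralProjection N hN B * ρ)) ∧
      (∀ C : Set ℝ, IsClosed C → C.Nonempty →
        C ⊆ ((NonDemolition.stateSpectralMeasure N hN ρ).restrict C).support →
        ∀ᵐ ξ ∂(NonDemolition.outcomeLaw N hN μ V ρ),
          (∀ k, 0 < (NonDemolition.trace (NonDemolition.spectralProjection N hN C *
            NonDemolition.posterior N hN V ρ k ξ)).re) ∧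
          Tendsto (fun k : ℕ => -((1 / k : ℝ) * Real.log
            (NonDemolition.trace (NonDemolition.spectralProjection N hN C *
              NonDemolition.posterior N hN V ρ k ξ)).re)) atTop
            (𝓝 (NonDemolition.relativeEntropy μ V (Ninf ξ) C))) := by
  have hσ : IsCompact (spectrum ℝ N) := spectrum.isCompact N
  have := NonDemolition.isProbabilityMeasure_stateSpectralMeasure hN hρ
  have := hV.isMarkovKernel_sequenceKernel
  have hmσ := NonDemolition.ae_mem_spectrum hN hρ
  obtain ⟨Ninf, hNm, hlim, hNν⟩ := NonDemolition.exists_measurable_limit_comp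
    (κ := hV.sequenceKernel) (fun k => (hNhat (k + 1) k.succ_pos).1) <| hmσ.mono fun ν hν =>
      (NonDemolition.ae_tendsto_maximumLikelihoodEstimator hV hf hσ hNhat hν).mono
        fun _ hξ => (tendsto_add_atTop_iff_nat 1).2 hξ
  refine ⟨NonDemolition.isOutcomeLaw_outcomeLaw hN hV hρ, Ninf, hNm, ?_, fun B hB => ?_,
    fun C hC hCne hCm => ?_⟩ <;> rw [NonDemolition.outcomeLaw_eq_comp hN hV hρ]
  · exact hlim.mono fun _ hξ => (tendsto_add_atTop_iff_nat 1).1 hξ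
  · rw [NonDemolition.trace_spectralProjection_mul hN hρ hB]
    exact congrArg _ <| (map_measureReal_apply hNm hB).symm.trans <| by
      rw [NonDemolition.map_comp_eq_of_ae_eq hNm hNν]
  · simp only [NonDemolition.trace_spectralProjection_mul_posterior hN hV hρ _ _ hC.measurableSet,
      Complex.ofReal_re]
    exact NonDemolition.ae_tendsto_log_posteriorProb hV hf hσ hmσ hNm hNν hC hCne hCm

theorem theorem2p2 {H : Type*} [NormedAddCommGroup H] [InnerProductSpace ℂ H] [CompleteSpace H]
    [TopologicalSpace.SeparableSpace H]
    {X : Type*} [MeasurableSpace X] (μ : Measure X) [SigmaFinite μ]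
    (N : H →L[ℂ] H) (hN : IsSelfAdjoint N)
    (V : X → ℝ → ℂ) (hV : NonDemolition.IsJumpFamily μ V)
    (ρ : H →L[ℂ] H) (hρ : NonDemolition.IsDensityMatrix ρ)
    (hf : NonDemolition.LikelihoodAssumption μ V (spectrum ℝ N))
    (Nhat : ℕ → (ℕ → X) → ℝ)
    (hNhat : NonDemolition.IsMaximumLikelihoodEstimator V (spectrum ℝ N) Nhat) :
    NonDemolition.IsOutcomeLaw N hN μ V ρ (NonDemolition.outcomeLaw N hN μ V ρ) ∧
    ∃ Ninf : (ℕ → X) → ℝ, Measurable Ninf ∧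
      (∀ᵐ ξ ∂(NonDemolition.outcomeLaw N hN μ V ρ),
        Tendsto (fun k => Nhat k ξ) atTop (𝓝 (Ninf ξ))) ∧
      (∀ B : Set ℝ, MeasurableSet B →
        (((NonDemolition.outcomeLaw N hN μ V ρ).real {ξ | Ninf ξ ∈ B} : ℝ) : ℂ) =
          NonDemolition.trace (NonDemolition.spectralProjection N hN B * ρ)) ∧
      (∀ O : Set ℝ, (∃ U : Set ℝ, IsOpen U ∧ O = U ∩ spectrum ℝ N) → O.Nonempty →
        closure O ⊆ (NonDemolition.stateSpectralMeasure N hN ρ).support →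
        ∀ᵐ ξ ∂(NonDemolition.outcomeLaw N hN μ V ρ),
          (∀ k, 0 < (NonDemolition.trace (NonDemolition.spectralProjection N hN (closure O) *
            NonDemolition.posterior N hN V ρ k ξ)).re) ∧
          Tendsto (fun k : ℕ => -((1 / k : ℝ) * Real.log
            (NonDemolition.trace (NonDemolition.spectralProjection N hN (closure O) *
              NonDemolition.posterior N hN V ρ k ξ)).re)) atTop
            (𝓝 (NonDemolition.relativeEntropy μ V (Ninf ξ) (closure O)))) := by
  obtain ⟨hlaw, Ninf, hmeas, hlim, hdist, hrate⟩ :=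
    theorem2p2_general μ N hN V hV ρ hρ hf Nhat hNhat
  refine ⟨hlaw, Ninf, hmeas, hlim, hdist, ?_⟩
  rintro _ ⟨U, hU, rfl⟩ hne hsupp
  exact hrate _ isClosed_closure hne.closure <| NonDemolition.closure_subset_support_restrict
    (NonDemolition.ae_mem_spectrum hN hρ) hU (subset_closure.trans hsupp)
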